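/- Let $q$ be an odd prime power and let $2 \le m < k$ be integers. An $(m\times k)$-system over $\mathbb{F}_q$ is a system $L=0$ of $m$ homogeneous linear equations in $k$ variables with coefficients in $\mathbb{F}_q$ whose $m\times k$ coefficient matrix, also denoted by $L$, has linearly independent rows. We say that $L$ induces an $\ell$-variable system $L'$ if there are distinct indices $i_1,\dots,i_\ell\in\{1,\dots,k\}$ such that for every $x\in\mathbb{F}_q^k$, $L(x_1,\dots,x_k)=0$ implies $L'(x_{i_1},\dots,x_{i_\ell})=0$. The system $L$ is redundant if it induces the equation $x_i-x_j=0$ for some $i\neq j$, and irredundant otherwise. For $n \ge 0$ and a two-colouring $c$ of $\mathbb{F}_q^n$, let $\mu_L(c)$ be the proportion of those solutions $(x_1,\dots,x_k)\in(\mathbb{F}_q^n)^k$ of $L=0$ that are monochromatic, i.e. for which $c(x_1)=\dots=c(x_k)$, and let $\rho_L(n)$ be the expected value of $\mu_L(c)$ when $c$ is a uniformly random two-colouring of $\mathbb{F}_q^n$. The system $L$ is common if for every $\varepsilon>0$ there is $N$ such that $\mu_L(c)\ge\rho_L(n)-\varepsilon$ for all $n\ge N$ and all two-colourings $c$ of $\mathbb{F}_q^n$;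 otherwise it is uncommon. Theorem. Let $L$ be an irredundant $(m\times k)$-system over $\mathbb{F}_q$. If $L$ induces some $(2\times 4)$-system, then $L$ is uncommon. -/

import Mathlib

namespace LinSys

/-- The rows of the coefficient matrix are linearly independent: `L` is an `(m × k)`-system. -/
def IsSystem {F : Type*} [Field F] {m k : ℕ} (L : Matrix (Fin m) (Fin k) F) : Prop :=
  LinearIndependent F L.row

/-- `L` induces the `l`-variable system `L'`: there are distinct indices `σ 0, …, σ (l - 1)` such
that every solution `x` of `L` over the field restricts to a solution
`(x (σ 0), …, x (σ (l - 1)))` of `L'`. -/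
def Induces {F : Type*} [Field F] {m k m' l : ℕ}
    (L : Matrix (Fin m) (Fin k) F) (L' : Matrix (Fin m') (Fin l) F) : Prop :=
  ∃ σ : Fin l ↪ Fin k, ∀ x : Fin k → F, L.mulVec x = 0 → L'.mulVec (fun a => x (σ a)) = 0

/-- `L` induces the equation `x_i - x_j = 0` for some `i ≠ j`. -/
def IsRedundant {F : Type*} [Field F] {m k : ℕ} (L : Matrix (Fin m) (Fin k) F) : Prop :=
  Induces L (!![1, -1] : Matrix (Fin 1) (Fin 2) F)

/-- The solutions of `L = 0` with all variables in `F ^ n`. -/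
def sol {F : Type*} [Field F] {m k : ℕ} (L : Matrix (Fin m) (Fin k) F) (n : ℕ) :
    Set (Fin k → (Fin n → F)) :=
  {x | ∀ i, ∑ j, L i j • x j = 0}

/-- The solutions of `L = 0` in `F ^ n` that are monochromatic for the two-colouring `c`. -/
def monoSol {F : Type*} [Field F] {m k : ℕ} (L : Matrix (Fin m) (Fin k) F) {n : ℕ}
    (c : (Fin n → F) → Bool) : Set (Fin k → (Fin n → F)) :=
  {x | x ∈ sol L n ∧ ∃ b : Bool, ∀ j, c (x j) = b}

/-- The proportion of solutions of `L = 0` in `F ^ n` that are monochromatic for `c`. (The zero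
vector is a solution, so over a finite field the denominator is positive.) -/
noncomputable def monoDensity {F : Type*} [Field F] {m k : ℕ} (L : Matrix (Fin m) (Fin k) F)
    {n : ℕ} (c : (Fin n → F) → Bool) : ℝ :=
  ((monoSol L c).ncard : ℝ) / ((sol L n).ncard : ℝ)

open Classical in
/-- The expected value of `monoDensity` for a uniformly random two-colouring of `F ^ n`, i.e. each
point is coloured independently, each colour having probability `1 / 2`. -/
noncomputable def randomDensity {F : Type*} [Field F] [Fintype F] {m k : ℕ}
    (L : Matrix (Fin m) (Fin k) F) (n : ℕ) : ℝ :=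
  (∑ c : (Fin n → F) → Bool, monoDensity L c) / (Fintype.card ((Fin n → F) → Bool) : ℝ)

/-- `L` is common: as `n → ∞`, every two-colouring of `F ^ n` has, up to an error `o(1)` in the
density, at least as many monochromatic solutions as a random two-colouring has on average. -/
def IsCommon {F : Type*} [Field F] [Fintype F] {m k : ℕ} (L : Matrix (Fin m) (Fin k) F) : Prop :=
  ∀ ε : ℝ, 0 < ε → ∃ N : ℕ, ∀ n : ℕ, N ≤ n → ∀ c : (Fin n → F) → Bool,
    randomDensity L n - ε ≤ monoDensity L c

/-- `L` is uncommon: it is not common. -/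
def IsUncommon {F : Type*} [Field F] [Fintype F] {m k : ℕ} (L : Matrix (Fin m) (Fin k) F) :
    Prop :=
  ¬ IsCommon L

end LinSys

/-! Colour each point `v` independently `true` with probability `h v`. Apart from the vanishing
share of solutions with repeated entries, the expected monochromatic density is the average of `∏ h
(x j) + ∏ (1 - h (x j))` over solutions. It suffices to find `h` keeping this below the random value
`2 * (1 / 2) ^ k` by a fixed amount (`isUncommon_of_density`).

Take `h = (1 + η * wave) / 2`, where `wave` sums real parts of characters of phase functions, each
rotated by a constant `θ j` in `ZMod 5`. Expanding the products gives every variable a label: a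
signed phase, or none. As the dimension grows, only label choices whose total phase is trivial on
the solution space survive (`tendsto_avg_prod_wave`). For small `η` the lowest power `η ^ d`
decides. Its coefficient is positive at `θ = 0`; if no surviving choice of size `d` is balanced (all
signed counts zero mod 5), it averages to zero over `θ`, so it is negative for some `θ`
(`exists_shift_eventually_lt_one`).

In the main case no variable vanishes and no two are proportional on the solution space. The phases
come from the two rows of the four-variable system and from a quadratic relation that they imply,
and `d = 4`. Odd sizes cancel between the two colours, size two would be a two-variable relation,
and a balanced choice of size four contradicts irredundancy (`no_surviving_pairing`).

In the degenerate cases linear phases suffice. A two-variable equation gives `d = 2`. If a variable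
is identically zero, fixing the colour of the point `0` suppresses one colour, so odd sizes count
and a three-variable equation gives `d = 3`. -/

namespace LinSys

/-! ### Averages over solutions, viewed as independent coordinates in the solution space. -/

section Average

variable {F ι : Type*} [Field F]

/-- The tuple of vectors of `F ^ n` whose `t`-th coordinates form the element `y t` of `K`. -/
def tuple (K : Submodule F (ι → F)) {n : ℕ} (y : Fin n → K) : ι → Fin n → F :=
  fun i t => (y t : ι → F) i

/-- The average of `G` over the tuples of vectors of `F ^ n` all of whose coordinates lie in `K`. -/
noncomputable def avg (K : Submodule F (ι → F)) [Fintype K] (n : ℕ)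
    (G : (ι → Fin n → F) → ℝ) : ℝ :=
  (∑ y : Fin n → K, G (tuple K y)) / (Fintype.card K : ℝ) ^ n

variable (K : Submodule F (ι → F)) [Fintype K] {n : ℕ}

lemma card_pow_pos : 0 < (Fintype.card K : ℝ) ^ n := by
  have : 0 < Fintype.card K := Fintype.card_pos
  positivity

lemma avg_mono {G H : (ι → Fin n → F) → ℝ} (h : ∀ y : Fin n → K, G (tuple K y) ≤ H (tuple K y)) :
    avg K n G ≤ avg K n H := by
  unfold avg
  have := card_pow_pos K (n := n)
  gcongr with y
  exact h y

lemma avg_add (G H : (ι → Fin n → F) → ℝ) :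
    avg K n (fun x => G x + H x) = avg K n G + avg K n H := by
  simp [avg, Finset.sum_add_distrib, add_div]

lemma avg_const_mul (a : ℝ) (G : (ι → Fin n → F) → ℝ) :
    avg K n (fun x => a * G x) = a * avg K n G := by
  simp [avg, ← Finset.mul_sum, mul_div_assoc]

lemma avg_const (a : ℝ) : avg K n (fun _ => a) = a := by
  have := (card_pow_pos K (n := n)).ne'
  simp [avg]

lemma avg_sum {α : Type*} (s : Finset α) (G : α → (ι → Fin n → F) → ℝ) :
    avg K n (fun x => ∑ a ∈ s, G a x) = ∑ a ∈ s, avg K n (G a) := by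
  unfold avg
  rw [Finset.sum_comm, Finset.sum_div]

open Classical in
-- Coordinates are independent, so it is enough that at most half of `K` satisfies `w i = w j`:
-- translation by `w₀` carries that part injectively into its complement.
lemma avg_eq_coords_le {i j : ι} (h : ∃ w ∈ K, w i ≠ w j) :
    avg K n (fun x => if x i = x j then 1 else 0) ≤ (1 / 2 : ℝ) ^ n := by
  obtain ⟨w₀, hw₀, hne⟩ := h
  set A : Finset K := Finset.univ.filter fun w => (w : ι → F) i = (w : ι → F) j with hA
  have hAcard : 2 * A.card ≤ Fintype.card K := by
    have h1 : A.card ≤ (Finset.univ.filter fun w : K => ¬ (w : ι → F) i = (w : ι → F) j).card := by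
      refine Finset.card_le_card_of_injOn (fun w => w + ⟨w₀, hw₀⟩) ?_ ?_
      · intro w hw
        simp only [hA, Finset.coe_filter, Finset.mem_univ, true_and, Set.mem_ofPred_eq] at hw ⊢
        simpa [hw] using hne
      · intro a _ b _ hab
        simpa using hab
    have h2 := Finset.card_filter_add_card_filter_not (s := (Finset.univ : Finset K))
      (fun w : K => (w : ι → F) i = (w : ι → F) j)
    rw [Finset.card_univ] at h2
    change A.card + _ = _ at h2
    omega
  have hsum : ∑ y : Fin n → K, (if tuple K y i = tuple K y j then (1 : ℝ) else 0)
      = (A.card : ℝ) ^ n := by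
    rw [Finset.sum_boole]
    have : (Finset.univ.filter fun y : Fin n → K => tuple K y i = tuple K y j)
        = Fintype.piFinset fun _ => A := by
      ext y
      simp [tuple, funext_iff, hA]
    rw [this]
    simp
  unfold avg
  rw [hsum, ← div_pow]
  have hK : (0 : ℝ) < Fintype.card K := by
    have : 0 < Fintype.card K := Fintype.card_pos
    positivity
  have : (2 : ℝ) * A.card ≤ Fintype.card K := by exact_mod_cast hAcard
  refine pow_le_pow_left₀ (by positivity) ?_ _
  rw [div_le_div_iff₀ hK two_pos]
  linarith

open Classical in
-- Union bound over pairs. It makes negligible the solutions with repeated entries, where the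
-- colours of the entries are not independent.
lemma avg_not_injective_le [Fintype ι] (h : ∀ i j, i ≠ j → ∃ w ∈ K, w i ≠ w j) :
    avg K n (fun x => if Function.Injective x then 0 else 1)
      ≤ (Fintype.card ι : ℝ) ^ 2 * (1 / 2 : ℝ) ^ n := by
  calc avg K n (fun x => if Function.Injective x then 0 else 1)
      ≤ avg K n (fun x => ∑ p ∈ (Finset.univ : Finset ι).offDiag,
          if x p.1 = x p.2 then 1 else 0) := by
        refine avg_mono K fun y => ?_
        split_ifs with hinj
        · exact Finset.sum_nonneg fun _ _ => by positivity
        · simp only [Function.Injective, not_forall] at hinj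
          obtain ⟨a, b, hab, hne⟩ := hinj
          have := Finset.single_le_sum
            (f := fun p : ι × ι => if tuple K y p.1 = tuple K y p.2 then (1 : ℝ) else 0)
            (fun p _ => by positivity)
            (show (a, b) ∈ (Finset.univ : Finset ι).offDiag by simpa using hne)
          simpa [hab] using this
    _ = ∑ p ∈ (Finset.univ : Finset ι).offDiag,
          avg K n (fun x => if x p.1 = x p.2 then 1 else 0) := avg_sum K _ _
    _ ≤ ∑ p ∈ (Finset.univ : Finset ι).offDiag, (1 / 2 : ℝ) ^ n :=
        Finset.sum_le_sum fun p hp => avg_eq_coords_le K (h _ _ (by simpa using hp))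
    _ ≤ _ := by
        rw [Finset.sum_const, nsmul_eq_mul]
        gcongr
        rw [Finset.offDiag_card, Finset.card_univ]
        have : Fintype.card ι * Fintype.card ι - Fintype.card ι ≤ Fintype.card ι ^ 2 := by
          rw [sq]; exact Nat.sub_le _ _
        exact_mod_cast this

end Average

/-! ### Colourings with independently chosen colours. -/

section RandomColouring

/-- The probability of the colouring `c` if each point `v` is independently given the colour `true`
with probability `h v`. -/
noncomputable def colProb {V : Type*} [Fintype V] (h : V → ℝ) (c : V → Bool) : ℝ :=
  ∏ v, if c v then h v else 1 - h v

variable {V : Type*} [Fintype V] (h : V → ℝ)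

lemma colProb_nonneg (h0 : ∀ v, 0 ≤ h v) (h1 : ∀ v, h v ≤ 1) (c : V → Bool) :
    0 ≤ colProb h c := by
  refine Finset.prod_nonneg fun v _ => ?_
  split_ifs
  · exact h0 v
  · linarith [h1 v]

variable [DecidableEq V]

lemma sum_colProb : ∑ c : V → Bool, colProb h c = 1 := by
  have := Finset.prod_univ_sum (fun _ : V => (Finset.univ : Finset Bool))
    (fun v b => if b then h v else 1 - h v)
  simp only [Fintype.piFinset_univ] at this
  simp [colProb, ← this]

/-- Injectivity makes the colours of the `x j` independent: the event is a product of one condition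
per point of `V`, so the sum over colourings factors over points. -/
lemma sum_colProb_const {ι : Type*} [Fintype ι] {x : ι → V} (hx : Function.Injective x) (b : Bool) :
    ∑ c : V → Bool, colProb h c * (if ∀ j, c (x j) = b then 1 else 0)
      = ∏ j, if b then h (x j) else 1 - h (x j) := by
  classical
  have key := Finset.prod_univ_sum (fun _ : V => (Finset.univ : Finset Bool))
    (fun v b' => (if b' then h v else 1 - h v) *
      (if v ∈ Finset.univ.image x → b' = b then 1 else 0))
  simp only [Fintype.piFinset_univ] at key
  have h1 : ∀ c : V → Bool, colProb h c * (if ∀ j, c (x j) = b then 1 else 0)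
      = ∏ v, (if c v then h v else 1 - h v) *
        (if v ∈ Finset.univ.image x → c v = b then 1 else 0) := by
    intro c
    rw [Finset.prod_mul_distrib, colProb, Finset.prod_ite_zero]
    simp
  simp only [h1]
  rw [← key]
  have h2 : ∀ v, (∑ b', (if b' = true then h v else 1 - h v) *
      (if v ∈ Finset.univ.image x → b' = b then (1 : ℝ) else 0))
      = if v ∈ Finset.univ.image x then (if b then h v else 1 - h v) else 1 := by
    intro v
    by_cases hv : v ∈ Finset.univ.image x
    · cases b <;> simp [hv]
    · simp [hv]
  simp only [h2]
  rw [Finset.prod_ite_mem, Finset.univ_inter, Finset.prod_image fun a _ b _ hab => hx hab]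

open Classical in
lemma sum_colProb_mono {ι : Type*} [Fintype ι] [Nonempty ι] {x : ι → V}
    (hx : Function.Injective x) :
    ∑ c : V → Bool, colProb h c * (if ∃ b, ∀ j, c (x j) = b then 1 else 0)
      = ∏ j, h (x j) + ∏ j, (1 - h (x j)) := by
  have h1 : ∀ c : V → Bool, (if ∃ b, ∀ j, c (x j) = b then (1 : ℝ) else 0)
      = (if ∀ j, c (x j) = true then 1 else 0) + (if ∀ j, c (x j) = false then 1 else 0) := by
    intro c
    obtain ⟨j₀⟩ := ‹Nonempty ι›
    by_cases ht : ∀ j, c (x j) = true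
    · have hf : ¬ ∀ j, c (x j) = false := fun hf => by simpa [ht j₀] using hf j₀
      have : ∃ b, ∀ j, c (x j) = b := ⟨_, ht⟩
      rw [if_pos this, if_pos ht, if_neg hf, add_zero]
    · by_cases hf : ∀ j, c (x j) = false
      · have : ∃ b, ∀ j, c (x j) = b := ⟨_, hf⟩
        rw [if_pos this, if_neg ht, if_pos hf, zero_add]
      · have : ¬ ∃ b, ∀ j, c (x j) = b := by
          rintro ⟨b, hb⟩
          cases b
          · exact hf hb
          · exact ht hb
        rw [if_neg this, if_neg ht, if_neg hf, zero_add]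
  simp only [h1, mul_add, Finset.sum_add_distrib, sum_colProb_const h hx]
  simp

end RandomColouring

/-! ### From a density function to uncommonness. -/

section Reduction

variable {F : Type*} [Field F] {m k : ℕ} (L : Matrix (Fin m) (Fin k) F)

/-- The space of solutions of `L` over the field. -/
abbrev solSpace : Submodule F (Fin k → F) := LinearMap.ker L.mulVecLin

lemma mem_solSpace {w : Fin k → F} : w ∈ solSpace L ↔ L.mulVec w = 0 := by
  simp [solSpace]

lemma isRedundant_of_eq {i j : Fin k} (hij : i ≠ j) (h : ∀ w ∈ solSpace L, w i = w j) :
    IsRedundant L := by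
  refine ⟨⟨![i, j], ?_⟩, fun x hx => ?_⟩
  · intro a b hab
    fin_cases a <;> fin_cases b <;> simp_all
  · have := h x ((mem_solSpace L).2 hx)
    ext a
    fin_cases a
    simp only [Matrix.mulVec, dotProduct, Fin.sum_univ_two]
    change 1 * x i + -1 * x j = 0
    rw [this]
    ring

lemma tuple_injective (K : Submodule F (Fin k → F)) {n : ℕ} :
    Function.Injective (tuple K (n := n)) := by
  intro y z hyz
  ext t i
  exact congrFun (congrFun hyz i) t

lemma range_tuple (n : ℕ) : Set.range (tuple (solSpace L) (n := n)) = sol L n := by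
  ext x
  constructor
  · rintro ⟨y, rfl⟩ i
    ext t
    have := congrFun ((mem_solSpace L).1 (y t).2) i
    simpa [tuple, Matrix.mulVec, dotProduct] using this
  · intro hx
    refine ⟨fun t => ⟨fun i => x i t, ?_⟩, rfl⟩
    rw [mem_solSpace]
    ext i
    have := congrFun (hx i) t
    simpa [Matrix.mulVec, dotProduct] using this

open Classical in
lemma monoDensity_eq_avg [Fintype (solSpace L)] {n : ℕ} (c : (Fin n → F) → Bool) :
    monoDensity L c
      = avg (solSpace L) n (fun x => if ∃ b, ∀ j, c (x j) = b then 1 else 0) := by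
  unfold monoDensity avg
  have h1 : monoSol L c = tuple (solSpace L) '' {y | ∃ b, ∀ j, c (tuple (solSpace L) y j) = b} := by
    ext x
    constructor
    · rintro ⟨hx, hb⟩
      rw [← range_tuple] at hx
      obtain ⟨y, rfl⟩ := hx
      exact ⟨y, hb, rfl⟩
    · rintro ⟨y, hb, rfl⟩
      exact ⟨range_tuple L n ▸ ⟨y, rfl⟩, hb⟩
  rw [h1, Set.ncard_image_of_injective _ (tuple_injective _), ← range_tuple, ← Set.image_univ,
    Set.ncard_image_of_injective _ (tuple_injective _), Set.ncard_univ, Finset.sum_boole,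
    Set.ncard_eq_toFinset_card', Nat.card_eq_fintype_card, Fintype.card_fun]
  simp

variable [Fintype F]

open Classical in
lemma sum_colProb_monoDensity [Fintype (solSpace L)] {n : ℕ} (h : (Fin n → F) → ℝ) :
    ∑ c, colProb h c * monoDensity L c = avg (solSpace L) n
      (fun x => ∑ c, colProb h c * (if ∃ b, ∀ j, c (x j) = b then 1 else 0)) := by
  rw [avg_sum]
  refine Finset.sum_congr rfl fun c _ => ?_
  rw [avg_const_mul, monoDensity_eq_avg]

lemma randomDensity_eq (n : ℕ) [DecidableEq F] :
    randomDensity L n = ∑ c, colProb (fun _ : Fin n → F => (1 / 2 : ℝ)) c * monoDensity L c := by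
  unfold randomDensity colProb
  rw [Finset.sum_div]
  refine Finset.sum_congr (by congr!) fun c _ => ?_
  norm_num
  ring

open Classical in
/-- A random colouring with density `h` shows that `L` is uncommon, if the solutions are
monochromatic with probability below `2 ^ (1 - k)` on average. -/
theorem isUncommon_of_density [NeZero k] (hirr : ¬ IsRedundant L) [Fintype (solSpace L)]
    {δ : ℝ} (hδ : 0 < δ)
    (H : ∀ N, ∃ n, N ≤ n ∧ ∃ (h : (Fin n → F) → ℝ) (G : (Fin k → Fin n → F) → ℝ),
      (∀ v, 0 ≤ h v) ∧ (∀ v, h v ≤ 1) ∧ (∀ y, 0 ≤ G (tuple (solSpace L) y)) ∧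
      (∀ y, Function.Injective (tuple (solSpace L) y) →
        ∏ j, h (tuple (solSpace L) y j) + ∏ j, (1 - h (tuple (solSpace L) y j))
          ≤ G (tuple (solSpace L) y)) ∧
      avg (solSpace L) n G ≤ 2 * (1 / 2 : ℝ) ^ k - δ) :
    IsUncommon L := by
  intro hcom
  -- Three errors of `δ / 4` occur: commonness itself, and the non-injective solutions once in the
  -- upper and once in the lower bound. Their sum stays below `δ`.
  obtain ⟨N₁, hN₁⟩ := hcom (δ / 4) (by positivity)
  have hlim : Filter.Tendsto (fun n : ℕ => (k : ℝ) ^ 2 * (1 / 2 : ℝ) ^ n) Filter.atTop (nhds 0) := by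
    simpa using (tendsto_pow_atTop_nhds_zero_of_lt_one (r := (1 / 2 : ℝ)) (by norm_num)
      (by norm_num)).const_mul ((k : ℝ) ^ 2)
  obtain ⟨N₂, hN₂⟩ := Filter.eventually_atTop.1 (hlim.eventually_lt_const (show 0 < δ / 4 by positivity))
  obtain ⟨n, hn, h, G, h0, h1, hG0, hG, hGavg⟩ := H (max N₁ N₂)
  have hsep : ∀ i j : Fin k, i ≠ j → ∃ w ∈ solSpace L, w i ≠ w j := by
    intro i j hij
    by_contra! hcon
    exact hirr (isRedundant_of_eq L hij hcon)
  have hni : avg (solSpace L) n (fun x => if Function.Injective x then 0 else 1) < δ / 4 := by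
    refine (avg_not_injective_le (solSpace L) hsep).trans_lt ?_
    simpa using hN₂ n ((le_max_right _ _).trans hn)
  have hprob : ∀ (g : (Fin n → F) → ℝ), (∀ v, 0 ≤ g v) → (∀ v, g v ≤ 1) →
      ∀ x : Fin k → Fin n → F,
      0 ≤ ∑ c, colProb g c * (if ∃ b, ∀ j, c (x j) = b then (1 : ℝ) else 0) ∧
      ∑ c, colProb g c * (if ∃ b, ∀ j, c (x j) = b then (1 : ℝ) else 0) ≤ 1 := by
    intro g g0 g1 x
    constructor
    · exact Finset.sum_nonneg fun c _ => mul_nonneg (colProb_nonneg g g0 g1 c) (by positivity)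
    · refine le_of_le_of_eq ?_ (sum_colProb g)
      refine Finset.sum_le_sum fun c _ => mul_le_of_le_one_right (colProb_nonneg g g0 g1 c) ?_
      split_ifs <;> norm_num
  have hupper : ∑ c, colProb h c * monoDensity L c ≤ 2 * (1 / 2 : ℝ) ^ k - δ + δ / 4 := by
    rw [sum_colProb_monoDensity]
    refine le_trans (avg_mono _ (H := fun x => G x + if Function.Injective x then 0 else 1)
      fun y => ?_) ((avg_add _ _ _).trans_le (by linarith))
    by_cases hy : Function.Injective (tuple (solSpace L) y)
    · simp only [hy, if_true, add_zero]
      refine le_of_eq_of_le ?_ (hG y hy)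
      convert sum_colProb_mono h hy
    · simp only [hy, if_false]
      linarith [(hprob h h0 h1 (tuple (solSpace L) y)).2, hG0 y]
  have hlower : 2 * (1 / 2 : ℝ) ^ k - δ / 4 ≤ randomDensity L n := by
    rw [randomDensity_eq, sum_colProb_monoDensity]
    have : 2 * (1 / 2 : ℝ) ^ k ≤ 1 := by
      obtain ⟨l, rfl⟩ := Nat.exists_eq_succ_of_ne_zero (NeZero.ne k)
      have : (1 / 2 : ℝ) ^ l ≤ 1 := pow_le_one₀ (by norm_num) (by norm_num)
      rw [pow_succ]
      linarith
    have h2 : avg (solSpace L) n (fun _ => 2 * (1 / 2 : ℝ) ^ k) ≤ avg (solSpace L) n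
        (fun x => (∑ c, colProb (fun _ : Fin n → F => (1 / 2 : ℝ)) c *
          (if ∃ b, ∀ j, c (x j) = b then (1 : ℝ) else 0)) +
          if Function.Injective x then 0 else 1) := by
      refine avg_mono _ fun y => ?_
      by_cases hy : Function.Injective (tuple (solSpace L) y)
      · simp only [hy, if_true, add_zero]
        refine le_of_le_of_eq (b := (1 / 2 : ℝ) ^ k + (1 - 1 / 2) ^ k) ?_ ?_
        · norm_num
          linarith
        · refine Eq.symm ?_
          convert sum_colProb_mono (fun _ : Fin n → F => (1 / 2 : ℝ)) hy <;> simp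
      · simp only [hy, if_false]
        linarith [(hprob (fun _ => 1 / 2) (by norm_num) (by norm_num)
          (tuple (solSpace L) y)).1]
    rw [avg_const, avg_add] at h2
    linarith
  -- Some colouring does at least as well as the mean; asking for positive probability as well
  -- allows the factor `colProb h c` to be cancelled.
  obtain ⟨c, -, hc⟩ : ∃ c ∈ (Finset.univ : Finset ((Fin n → F) → Bool)),
      colProb h c * monoDensity L c ≤ colProb h c * (2 * (1 / 2 : ℝ) ^ k - δ + δ / 4) ∧
      0 < colProb h c := by
    by_contra! hcon
    have hlt : ∑ c, colProb h c * (2 * (1 / 2 : ℝ) ^ k - δ + δ / 4)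
        < ∑ c, colProb h c * monoDensity L c := by
      obtain ⟨c₀, -, hc₀⟩ : ∃ c ∈ (Finset.univ : Finset ((Fin n → F) → Bool)),
          0 < colProb h c :=
        Finset.exists_lt_of_sum_lt (by simp [sum_colProb])
      refine Finset.sum_lt_sum (fun c _ => ?_) ⟨c₀, Finset.mem_univ _, ?_⟩
      · by_contra! hc
        have := le_antisymm (hcon c (Finset.mem_univ _) hc.le) (colProb_nonneg h h0 h1 c)
        simp [this] at hc
      · by_contra! hc
        exact (hcon c₀ (Finset.mem_univ _) hc).not_gt hc₀
    rw [← Finset.sum_mul, sum_colProb, one_mul] at hlt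
    linarith
  have hc' := le_of_mul_le_mul_left hc.1 hc.2
  have := hN₁ n ((le_max_left _ _).trans hn) c
  linarith

end Reduction

/-! ### Fourier expansion of products of waves. -/

section Fourier

lemma addChar_map_sum {A α : Type*} [AddCommMonoid A] (χ : AddChar A ℂ) (s : Finset α) (u : α → A) :
    χ (∑ a ∈ s, u a) = ∏ a ∈ s, χ (u a) := by
  classical
  induction s using Finset.induction_on with
  | empty => simp
  | insert a s ha ih => rw [Finset.sum_insert ha, Finset.prod_insert ha, χ.map_add_eq_mul, ih]

variable {F ι J : Type*} [Field F]

/-- The phase function attached to a label: a signed index, or nothing. -/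
def phase (φ : J → Fin 3 → F → F) : Option (J × ℤˣ) → Fin 3 → F → F
  | none, _, _ => 0
  | some (j, e), s, w => ((e : ℤ) : F) * φ j s w

/-- The constant phase attached to a label. -/
def shift (θ : J → ZMod 5) : Option (J × ℤˣ) → ZMod 5
  | none => 0
  | some (j, e) => ((e : ℤ) : ZMod 5) * θ j

/-- The coefficient with which a label contributes to `1 + η * wave`. -/
def coeff (η : ℝ) : Option (J × ℤˣ) → ℝ
  | none => 1
  | some _ => η

/-- The complex exponential attached to a label. -/
noncomputable def term (χ : AddChar F ℂ) (φ : J → Fin 3 → F → F) (θ : J → ZMod 5) {N : ℕ}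
    (o : Option (J × ℤˣ)) (x : Fin (N * 3) → F) : ℂ :=
  ZMod.stdAddChar (shift θ o) * χ (∑ t, phase φ o t.modNat (x t))

/-- A real trigonometric sum with phases `φ`, shifted by `θ`. -/
noncomputable def wave [Fintype J] (χ : AddChar F ℂ) (φ : J → Fin 3 → F → F) (θ : J → ZMod 5)
    {N : ℕ} (x : Fin (N * 3) → F) : ℝ :=
  ∑ j, 2 * ((ZMod.stdAddChar (θ j) : ℂ) * χ (∑ t, φ j t.modNat (x t))).re

/-- The contribution of a choice of labels to the average of a product of waves over the
solutions, for one block of three coordinates. -/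
noncomputable def blockMean [Fintype ι] (K : Submodule F (ι → F)) [Fintype K] (χ : AddChar F ℂ)
    (φ : J → Fin 3 → F → F) (μ : ι → Option (J × ℤˣ)) : ℂ :=
  ∏ s, (∑ w : K, χ (∑ i, phase φ (μ i) s ((w : ι → F) i))) / (Fintype.card K : ℂ)

/-- The labels `μ` survive if the total phase is trivial on `K`. -/
def Survives [Fintype ι] (K : Submodule F (ι → F)) (χ : AddChar F ℂ)
    (φ : J → Fin 3 → F → F) (μ : ι → Option (J × ℤˣ)) : Prop :=
  ∀ s, ∀ w ∈ K, χ (∑ i, phase φ (μ i) s (w i)) = 1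

/-- The coordinates form `N` blocks of three, the residue mod 3 selecting one of three phase
functions. Equal blocks turn the average into an `N`-th power. -/
lemma prod_modNat (α : Fin 3 → ℂ) (N : ℕ) : ∏ t : Fin (N * 3), α t.modNat = (∏ s, α s) ^ N := by
  rw [← Fintype.prod_equiv finProdFinEquiv (fun p : Fin N × Fin 3 => α p.2) _ ?_]
  · rw [Fintype.prod_prod_type]
    simp
  · intro p
    have := congrArg Prod.snd (finProdFinEquiv.symm_apply_apply p)
    exact congrArg α this.symm

lemma abs_wave_le [Finite F] [Fintype J] (χ : AddChar F ℂ) (φ : J → Fin 3 → F → F)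
    (θ : J → ZMod 5) {N : ℕ} (x : Fin (N * 3) → F) :
    |wave χ φ θ x| ≤ 2 * Fintype.card J := by
  refine (Finset.abs_sum_le_sum_abs _ _).trans ?_
  calc _ ≤ ∑ _j : J, (2 : ℝ) := Finset.sum_le_sum fun j _ => by
        rw [abs_mul, abs_two]
        refine mul_le_of_le_one_right zero_le_two ((Complex.abs_re_le_norm _).trans ?_)
        rw [norm_mul, AddChar.norm_apply, AddChar.norm_apply, one_mul]
    _ = _ := by simp [mul_comm]

/-- Twice a real part is the number plus its conjugate, and conjugation negates the phase: hence the
signs in the labels. The label `none` is the summand `1`. -/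
lemma one_add_wave [Finite F] [Fintype J] (χ : AddChar F ℂ) (φ : J → Fin 3 → F → F)
    (θ : J → ZMod 5) {N : ℕ} (η : ℝ) (x : Fin (N * 3) → F) :
    ((1 + η * wave χ φ θ x : ℝ) : ℂ)
      = ∑ o : Option (J × ℤˣ), (coeff η o : ℂ) * term χ φ θ o x := by
  have h : ∀ j : J, ((2 * ((ZMod.stdAddChar (θ j) : ℂ) * χ (∑ t, φ j t.modNat (x t))).re : ℝ) : ℂ)
      = ∑ e : ℤˣ, term χ φ θ (some (j, e)) x := by
    intro j
    simp only [UnitsInt.univ, term, shift, phase]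
    rw [Finset.sum_pair (by decide)]
    have := Complex.add_conj ((ZMod.stdAddChar (θ j) : ℂ) * χ (∑ t, φ j t.modNat (x t)))
    rw [← this]
    simp only [Units.val_one, Int.cast_one, one_mul, Units.val_neg, Int.cast_neg, neg_mul,
      Finset.sum_neg_distrib, AddChar.map_neg_eq_conj, map_mul]
  rw [Fintype.sum_option, Fintype.sum_prod_type]
  simp only [coeff, ← Finset.mul_sum, ← h, wave, ← Complex.ofReal_sum]
  simp only [term, shift, phase, Finset.sum_const_zero, AddChar.map_zero_eq_one, mul_one]
  push_cast
  rfl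

variable [Fintype ι] (K : Submodule F (ι → F)) [Fintype K]

/-- Each choice of labels in the expanded product gives a product over coordinates, and these are
averaged independently over `K`. -/
lemma avg_prod_wave [Finite F] [DecidableEq ι] [Fintype J] (χ : AddChar F ℂ) (φ : J → Fin 3 → F → F)
    (θ : J → ZMod 5) (η : ι → ℝ) (N : ℕ) :
    ((avg K (N * 3) (fun x => ∏ i, (1 + η i * wave χ φ θ (x i))) : ℝ) : ℂ)
      = ∑ μ : ι → Option (J × ℤˣ), ((∏ i, coeff (η i) (μ i) : ℝ) : ℂ) *
          ZMod.stdAddChar (∑ i, shift θ (μ i)) * blockMean K χ φ μ ^ N := by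
  classical
  unfold avg
  have h1 : ∀ y : Fin (N * 3) → K,
      ((∏ i, (1 + η i * wave χ φ θ (tuple K y i)) : ℝ) : ℂ)
      = ∑ μ : ι → Option (J × ℤˣ), ∏ i, ((coeff (η i) (μ i) : ℂ) * term χ φ θ (μ i) (tuple K y i)) := by
    intro y
    rw [Complex.ofReal_prod]
    simp only [one_add_wave]
    rw [Finset.prod_univ_sum, Fintype.piFinset_univ]
  rw [Complex.ofReal_div, Complex.ofReal_sum]
  simp only [h1]
  rw [Finset.sum_comm, Finset.sum_div]
  refine Finset.sum_congr rfl fun μ _ => ?_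
  have h2 : ∀ y : Fin (N * 3) → K,
      ∏ i, ((coeff (η i) (μ i) : ℂ) * term χ φ θ (μ i) (tuple K y i))
      = ((∏ i, coeff (η i) (μ i) : ℝ) : ℂ) * ZMod.stdAddChar (∑ i, shift θ (μ i)) *
        ∏ t, χ (∑ i, phase φ (μ i) t.modNat ((y t : ι → F) i)) := by
    intro y
    simp only [Finset.prod_mul_distrib, term, addChar_map_sum, Complex.ofReal_prod,
      mul_assoc]
    rw [Finset.prod_comm (f := fun i t => χ (phase φ (μ i) t.modNat (tuple K y i t)))]
    rfl
  simp only [h2]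
  rw [← Finset.mul_sum, mul_div_assoc]
  congr 1
  have h3 := Finset.prod_univ_sum (fun _ : Fin (N * 3) => (Finset.univ : Finset K))
    (fun t w => χ (∑ i, phase φ (μ i) t.modNat ((w : ι → F) i)))
  rw [Fintype.piFinset_univ] at h3
  rw [← h3]
  unfold blockMean
  rw [← prod_modNat, Finset.prod_div_distrib]
  simp

lemma blockMean_of_survives {χ : AddChar F ℂ} {φ : J → Fin 3 → F → F}
    {μ : ι → Option (J × ℤˣ)} (h : Survives K χ φ μ) : blockMean K χ φ μ = 1 := by
  refine Finset.prod_eq_one fun s _ => ?_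
  have : ∀ w : K, χ (∑ i, phase φ (μ i) s ((w : ι → F) i)) = 1 := fun w => h s w w.2
  simp [this]

/-- Distinct unit vectors do not lie on one ray, so the triangle inequality is strict for the pair
`a`, `b`. -/
lemma norm_sum_lt_card {α : Type*} [Fintype α] {u : α → ℂ} (hu : ∀ a, ‖u a‖ = 1) {a b : α}
    (hab : u a ≠ u b) : ‖∑ c, u c‖ < Fintype.card α := by
  classical
  have hne : a ≠ b := fun h => hab (h ▸ rfl)
  rw [← Finset.add_sum_erase _ _ (Finset.mem_univ a), ← Finset.add_sum_erase _ _
    (Finset.mem_erase.2 ⟨hne.symm, Finset.mem_univ b⟩), ← add_assoc]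
  have h1 : ‖u a + u b‖ < 2 := by
    have : ¬ SameRay ℝ (u a) (u b) := by
      rw [sameRay_iff_of_norm_eq ((hu a).trans (hu b).symm)]
      exact hab
    have := norm_add_lt_of_not_sameRay this
    rw [hu, hu] at this
    linarith
  have h2 : ‖∑ c ∈ (Finset.univ.erase a).erase b, u c‖ ≤ Fintype.card α - 2 := by
    refine (norm_sum_le _ _).trans ?_
    simp only [hu, Finset.sum_const, nsmul_eq_mul, mul_one]
    rw [Finset.card_erase_of_mem (Finset.mem_erase.2 ⟨hne.symm, Finset.mem_univ b⟩),
      Finset.card_erase_of_mem (Finset.mem_univ a), Finset.card_univ]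
    have : 2 ≤ Fintype.card α := Fintype.one_lt_card_iff.2 ⟨a, b, hne⟩
    rw [Nat.sub_sub, Nat.cast_sub this]
    norm_num
  linarith [norm_add_le (u a + u b) (∑ c ∈ (Finset.univ.erase a).erase b, u c)]

/-- In a coordinate where survival fails, the character takes a value other than `1`, while at `w =
0` it equals `1` because the phases vanish there. That factor is strictly below `1` in norm, and the
others are at most `1`. -/
lemma norm_blockMean_lt_one [Finite F] {χ : AddChar F ℂ} {φ : J → Fin 3 → F → F}
    (hφ : ∀ j s, φ j s 0 = 0) {μ : ι → Option (J × ℤˣ)} (h : ¬ Survives K χ φ μ) :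
    ‖blockMean K χ φ μ‖ < 1 := by
  have hK : (0 : ℝ) < Fintype.card K := by
    have : 0 < Fintype.card K := Fintype.card_pos
    positivity
  unfold Survives at h
  push Not at h
  obtain ⟨s, w, hw, hne⟩ := h
  unfold blockMean
  rw [norm_prod, ← Finset.mul_prod_erase _ _ (Finset.mem_univ s)]
  refine mul_lt_one_of_nonneg_of_lt_one_left (norm_nonneg _) ?_
    (Finset.prod_le_one (fun _ _ => norm_nonneg _) fun r _ => ?_)
  · rw [norm_div, Complex.norm_natCast, div_lt_one hK]
    refine norm_sum_lt_card (fun _ => AddChar.norm_apply _ _) (a := ⟨w, hw⟩) (b := 0) ?_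
    have h0 : ∑ i, phase φ (μ i) s (((0 : K) : ι → F) i) = 0 :=
      Finset.sum_eq_zero fun i _ => by
        rcases μ i with _ | ⟨j, e⟩ <;> simp [phase, hφ]
    rw [h0, AddChar.map_zero_eq_one]
    exact hne
  · rw [norm_div, Complex.norm_natCast, div_le_one hK]
    refine (norm_sum_le _ _).trans ?_
    simp [AddChar.norm_apply]

/-- Surviving terms are constant in `N` and the rest decay geometrically. The amplitude `η` may
depend on the variable so that a single variable can be switched off. -/
lemma tendsto_avg_prod_wave [Finite F] [DecidableEq ι] [Fintype J] (χ : AddChar F ℂ)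
    {φ : J → Fin 3 → F → F} [DecidablePred (Survives K χ φ)] (hφ : ∀ j s, φ j s 0 = 0) (θ : J → ZMod 5) (η : ι → ℝ) :
    Filter.Tendsto (fun N => avg K (N * 3) (fun x => ∏ i, (1 + η i * wave χ φ θ (x i))))
      Filter.atTop (nhds (∑ μ : ι → Option (J × ℤˣ) with Survives K χ φ μ,
        (∏ i, coeff (η i) (μ i)) * (ZMod.stdAddChar (∑ i, shift θ (μ i)) : ℂ).re)) := by
  have key : Filter.Tendsto (fun N => ((avg K (N * 3)
      (fun x => ∏ i, (1 + η i * wave χ φ θ (x i))) : ℝ) : ℂ)) Filter.atTop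
      (nhds (∑ μ : ι → Option (J × ℤˣ), if Survives K χ φ μ then ((∏ i, coeff (η i) (μ i) : ℝ) : ℂ) *
        ZMod.stdAddChar (∑ i, shift θ (μ i)) else 0)) := by
    simp only [avg_prod_wave]
    refine tendsto_finsetSum _ fun μ _ => ?_
    split_ifs with hμ
    · simp [blockMean_of_survives K hμ]
    · simpa using (tendsto_pow_atTop_nhds_zero_of_norm_lt_one
        (norm_blockMean_lt_one K hφ hμ)).const_mul
        (((∏ i, coeff (η i) (μ i) : ℝ) : ℂ) * ZMod.stdAddChar (∑ i, shift θ (μ i)))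
  have := (Complex.continuous_re.tendsto _).comp key
  simp only [Function.comp_def, Complex.ofReal_re] at this
  convert this using 2
  rw [Complex.re_sum, Finset.sum_filter]
  refine Finset.sum_congr rfl fun μ _ => ?_
  split_ifs
  · rw [Complex.re_ofReal_mul]
  · simp

end Fourier

/-! ### Choosing the constant shifts so that the leading coefficient is negative. -/

section LeadingTerm

variable {ι J : Type*} [Fintype ι]

/-- The signed number of occurrences of `j` among the labels. -/
def charge [DecidableEq J] (j : J) : Option (J × ℤˣ) → ZMod 5
  | none => 0
  | some (j', e) => if j' = j then ((e : ℤ) : ZMod 5) else 0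

lemma shift_eq_sum [Fintype J] [DecidableEq J] (θ : J → ZMod 5) (o : Option (J × ℤˣ)) :
    shift θ o = ∑ j, charge j o * θ j := by
  rcases o with _ | ⟨j, e⟩ <;> simp [shift, charge]

/-- The total shift is a linear form in `θ` whose coefficients are the charges, so this is
orthogonality of characters on `J → ZMod 5`. -/
lemma sum_stdAddChar_shift [Fintype J] [DecidableEq J] {μ : ι → Option (J × ℤˣ)}
    (h : ∃ j, ∑ i, charge j (μ i) ≠ 0) :
    ∑ θ : J → ZMod 5, (ZMod.stdAddChar (∑ i, shift θ (μ i)) : ℂ) = 0 := by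
  obtain ⟨j, hj⟩ := h
  have h1 : ∀ θ : J → ZMod 5, (ZMod.stdAddChar (∑ i, shift θ (μ i)) : ℂ)
      = ∏ j, ZMod.stdAddChar (θ j * ∑ i, charge j (μ i)) := by
    intro θ
    rw [← addChar_map_sum]
    congr 1
    simp only [shift_eq_sum]
    rw [Finset.sum_comm]
    refine Finset.sum_congr rfl fun j _ => ?_
    rw [← Finset.sum_mul, mul_comm]
  simp only [h1]
  have h2 := Finset.prod_univ_sum (fun _ : J => (Finset.univ : Finset (ZMod 5)))
    (fun j a => (ZMod.stdAddChar (a * ∑ i, charge j (μ i)) : ℂ))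
  rw [Fintype.piFinset_univ] at h2
  rw [← h2]
  refine Finset.prod_eq_zero (Finset.mem_univ j) ?_
  rw [AddChar.sum_mulShift _ (ZMod.isPrimitive_stdAddChar 5), if_neg hj]
  simp

/-- The set of variables that carry a label. -/
def labelled [DecidableEq J] (μ : ι → Option (J × ℤˣ)) : Finset ι :=
  Finset.univ.filter fun i => (μ i).isSome

lemma prod_coeff_const [DecidableEq J] (η : ℝ) (μ : ι → Option (J × ℤˣ)) :
    ∏ i, coeff η (μ i) = η ^ (labelled μ).card := by
  have : ∀ i, coeff η (μ i) = if (μ i).isSome then η else 1 := by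
    intro i
    rcases μ i with _ | p <;> simp [coeff]
  simp only [this]
  rw [Finset.prod_ite]
  simp [labelled]

lemma exists_shift_eventually_lt_one [Fintype J] [DecidableEq J] (T : Finset (ι → Option (J × ℤˣ))) {d : ℕ}
    (hd : 0 < d) (hlow : ∀ μ ∈ T, μ ≠ (fun _ => none) → d ≤ (labelled μ).card)
    (hlead : ∃ μ ∈ T, (labelled μ).card = d)
    (hbal : ∀ μ ∈ T, (labelled μ).card = d → ∃ j, ∑ i, charge j (μ i) ≠ 0) :
    ∃ θ : J → ZMod 5, ∀ᶠ η : ℝ in nhdsWithin 0 (Set.Ioi 0),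
      ∑ μ ∈ T, η ^ (labelled μ).card * (ZMod.stdAddChar (∑ i, shift θ (μ i)) : ℂ).re < 1 := by
  classical
  set re : (J → ZMod 5) → (ι → Option (J × ℤˣ)) → ℝ :=
    fun θ μ => (ZMod.stdAddChar (∑ i, shift θ (μ i)) : ℂ).re with hre
  have hre_le : ∀ θ μ, re θ μ ≤ 1 := fun θ μ =>
    (Complex.re_le_norm _).trans_eq (AddChar.norm_apply _ _)
  have hre_zero : ∀ μ, re 0 μ = 1 := by
    intro μ
    have : ∀ o : Option (J × ℤˣ), shift (0 : J → ZMod 5) o = 0 := by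
      rintro (_ | ⟨j, e⟩) <;> simp [shift]
    simp [hre, this]
  set T₁ := T.filter fun μ => (labelled μ).card = d
  -- The leading coefficients sum to zero over `θ`. Were they all nonnegative, they would all
  -- vanish, but at `θ = 0` the coefficient is the number of leading terms.
  obtain ⟨θ, hθ⟩ : ∃ θ, ∑ μ ∈ T₁, re θ μ < 0 := by
    by_contra! hcon
    have hsum : ∑ θ, ∑ μ ∈ T₁, re θ μ = 0 := by
      rw [Finset.sum_comm]
      refine Finset.sum_eq_zero fun μ hμ => ?_
      rw [← Complex.re_sum, sum_stdAddChar_shift (hbal μ (Finset.mem_filter.1 hμ).1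
        (Finset.mem_filter.1 hμ).2), Complex.zero_re]
    have h0 := (Finset.sum_eq_zero_iff_of_nonneg fun θ _ => hcon θ).1 hsum 0 (Finset.mem_univ _)
    simp only [hre_zero] at h0
    obtain ⟨μ, hμ, hμd⟩ := hlead
    have : μ ∈ T₁ := Finset.mem_filter.2 ⟨hμ, hμd⟩
    have : 0 < T₁.card := Finset.card_pos.2 ⟨μ, this⟩
    simp at h0
    simp [h0] at this
  refine ⟨θ, ?_⟩
  set p := ∑ μ ∈ T₁, re θ μ with hp
  -- The sum will be at most `1 + η ^ d * p + T.card * η ^ (d + 1)`, and `p < 0` wins once `η` is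
  -- this small.
  have hev : ∀ᶠ η : ℝ in nhdsWithin 0 (Set.Ioi 0), η < 1 ∧ η * (T.card + 1) < -p := by
    refine Filter.Eventually.and ?_ ?_
    · exact nhdsWithin_le_nhds (Iio_mem_nhds one_pos)
    · have : Filter.Tendsto (fun η : ℝ => η * (T.card + 1)) (nhdsWithin 0 (Set.Ioi 0))
          (nhds (0 * (T.card + 1))) :=
        (Continuous.tendsto (by fun_prop) 0).mono_left nhdsWithin_le_nhds
      exact this.eventually_lt_const (by simpa using hθ)
  filter_upwards [hev, self_mem_nhdsWithin] with η ⟨hη1, hηp⟩ hη0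
  rw [Set.mem_Ioi] at hη0
  change ∑ μ ∈ T, η ^ (labelled μ).card * re θ μ < 1
  have hterm : ∀ μ ∈ T, η ^ (labelled μ).card * re θ μ ≤
      (if μ = (fun _ => none) then 1 else 0) +
      (if (labelled μ).card = d then η ^ d * re θ μ else 0) + η ^ (d + 1) := by
    intro μ hμ
    have hpow : 0 < η ^ (d + 1) := pow_pos hη0 _
    by_cases h0 : μ = fun _ => none
    · have : (labelled μ).card = 0 := by simp [labelled, h0]
      rw [if_pos h0, if_neg (by omega), this, pow_zero, one_mul]
      linarith [hre_le θ μ]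
    · rw [if_neg h0, zero_add]
      split_ifs with hc
      · rw [hc]
        linarith
      · have hlt : d + 1 ≤ (labelled μ).card := by
          have := hlow μ hμ h0
          omega
        rw [zero_add]
        calc η ^ (labelled μ).card * re θ μ ≤ η ^ (labelled μ).card * 1 := by
              gcongr
              exact hre_le θ μ
          _ ≤ η ^ (d + 1) := by
              rw [mul_one]
              exact pow_le_pow_of_le_one hη0.le hη1.le hlt
  refine (Finset.sum_le_sum hterm).trans_lt ?_
  rw [Finset.sum_add_distrib, Finset.sum_add_distrib, ← Finset.sum_filter (p := fun μ =>
    (labelled μ).card = d), ← Finset.mul_sum, ← hp, Finset.sum_const, nsmul_eq_mul]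
  have h1 : ∑ μ ∈ T, (if μ = (fun _ => none) then (1 : ℝ) else 0) ≤ 1 := by
    rw [Finset.sum_ite_eq' T]
    split_ifs <;> norm_num
  have h2 : η ^ d * p + T.card * η ^ (d + 1) < 0 := by
    have : η ^ d * p + T.card * η ^ (d + 1) = η ^ d * (p + η * T.card) := by ring
    rw [this]
    exact mul_neg_of_pos_of_neg (pow_pos hη0 _) (by linarith)
  linarith

end LeadingTerm

/-! ### Two criteria for uncommonness in terms of surviving labels. -/

section Criteria

variable {F J : Type*} [Field F] [Fintype F] [Fintype J] {m k : ℕ}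
  {L : Matrix (Fin m) (Fin k) F} {χ : AddChar F ℂ} {φ : J → Fin 3 → F → F}

lemma exists_pos_small (a : ℝ) : ∀ᶠ η : ℝ in nhdsWithin 0 (Set.Ioi 0), 0 < η ∧ η * a ≤ 1 := by
  have : Filter.Tendsto (fun η : ℝ => η * a) (nhdsWithin 0 (Set.Ioi 0)) (nhds (0 * a)) :=
    (Continuous.tendsto (by fun_prop) 0).mono_left nhdsWithin_le_nhds
  filter_upwards [self_mem_nhdsWithin, this.eventually_le_const (by simp : 0 * a < 1)] with η h0 h1
  exact ⟨h0, h1⟩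

lemma abs_mul_wave_le {θ : J → ZMod 5} {η : ℝ} (h0 : 0 < η)
    (h1 : η * (2 * Fintype.card J) ≤ 1) {N : ℕ} (v : Fin (N * 3) → F) :
    |η * wave χ φ θ v| ≤ 1 := by
  rw [abs_mul, abs_of_pos h0]
  exact (mul_le_mul_of_nonneg_left (abs_wave_le χ φ θ v) h0.le).trans h1

variable [DecidableEq J]

/-- Uncommonness from the leading term over the label choices of even size. -/
theorem isUncommon_of_even [NeZero k] (hirr : ¬ IsRedundant L) (hφ : ∀ j s, φ j s 0 = 0) {d : ℕ}
    (hd : 0 < d) (hdeven : Even d)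
    (hlow : ∀ μ, Survives (solSpace L) χ φ μ → Even (labelled μ).card → μ ≠ (fun _ => none) →
      d ≤ (labelled μ).card)
    (hlead : ∃ μ, Survives (solSpace L) χ φ μ ∧ (labelled μ).card = d)
    (hbal : ∀ μ, Survives (solSpace L) χ φ μ → (labelled μ).card = d →
      ∃ j, ∑ i, charge j (μ i) ≠ 0) :
    IsUncommon L := by
  classical
  obtain ⟨θ, hθ⟩ := exists_shift_eventually_lt_one
    (Finset.univ.filter fun μ : Fin k → Option (J × ℤˣ) =>
      Survives (solSpace L) χ φ μ ∧ Even (labelled μ).card) hd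
    (fun μ hμ => hlow μ (Finset.mem_filter.1 hμ).2.1 (Finset.mem_filter.1 hμ).2.2)
    (by
      obtain ⟨μ, hμ, hμd⟩ := hlead
      exact ⟨μ, by simpa [hμ, hμd] using hdeven, hμd⟩)
    (fun μ hμ => hbal μ (Finset.mem_filter.1 hμ).2.1)
  obtain ⟨η, hη, hη0, hη1⟩ := (hθ.and (exists_pos_small (2 * Fintype.card J))).exists
  set l := ∑ μ : Fin k → Option (J × ℤˣ) with
      (Survives (solSpace L) χ φ μ ∧ Even (labelled μ).card),
    η ^ (labelled μ).card * (ZMod.stdAddChar (∑ i, shift θ (μ i)) : ℂ).re with hl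
  have hlim := (((tendsto_avg_prod_wave (solSpace L) χ hφ θ (fun _ => η)).add
    (tendsto_avg_prod_wave (solSpace L) χ hφ θ (fun _ => -η))).const_mul ((1 / 2 : ℝ) ^ k))
  -- Passing from `h` to `1 - h` replaces `η` by `-η`, so odd sizes cancel and even sizes double.
  have hval : (∑ μ : Fin k → Option (J × ℤˣ) with Survives (solSpace L) χ φ μ,
        (∏ i, coeff η (μ i)) * (ZMod.stdAddChar (∑ i, shift θ (μ i)) : ℂ).re)
      + (∑ μ : Fin k → Option (J × ℤˣ) with Survives (solSpace L) χ φ μ,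
        (∏ i, coeff (-η) (μ i)) * (ZMod.stdAddChar (∑ i, shift θ (μ i)) : ℂ).re) = 2 * l := by
    rw [← Finset.sum_add_distrib, hl, ← Finset.filter_filter, Finset.sum_filter (p := fun μ =>
      Even (labelled μ).card), Finset.mul_sum]
    refine Finset.sum_congr rfl fun μ _ => ?_
    rw [prod_coeff_const, prod_coeff_const]
    split_ifs with he
    · rw [he.neg_pow]
      ring
    · rw [(Nat.not_even_iff_odd.1 he).neg_pow]
      ring
  rw [hval] at hlim
  have hpos : (0 : ℝ) < (1 / 2) ^ k := by positivity
  have hev := hlim.eventually_le_const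
    (show (1 / 2 : ℝ) ^ k * (2 * l) < 2 * (1 / 2 : ℝ) ^ k - (1 / 2) ^ k * (1 - l) by
      nlinarith)
  obtain ⟨N₀, hN₀⟩ := Filter.eventually_atTop.1 hev
  refine isUncommon_of_density L hirr (δ := (1 / 2) ^ k * (1 - l))
    (mul_pos hpos (by linarith)) fun N => ?_
  refine ⟨max N N₀ * 3, by omega, fun v => (1 / 2) * (1 + η * wave χ φ θ v),
    fun x => (1 / 2 : ℝ) ^ k * (∏ i, (1 + η * wave χ φ θ (x i)) +
      ∏ i, (1 + -η * wave χ φ θ (x i))), ?_, ?_, ?_, ?_, ?_⟩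
  · intro v
    linarith [(abs_le.1 (abs_mul_wave_le (χ := χ) (φ := φ) (θ := θ) hη0 hη1 v)).1]
  · intro v
    linarith [(abs_le.1 (abs_mul_wave_le (χ := χ) (φ := φ) (θ := θ) hη0 hη1 v)).2]
  · intro y
    refine mul_nonneg hpos.le (add_nonneg (Finset.prod_nonneg fun i _ => ?_)
      (Finset.prod_nonneg fun i _ => ?_))
    · linarith [(abs_le.1 (abs_mul_wave_le (χ := χ) (φ := φ) (θ := θ) hη0 hη1
        (tuple (solSpace L) y i))).1]
    · linarith [(abs_le.1 (abs_mul_wave_le (χ := χ) (φ := φ) (θ := θ) hη0 hη1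
        (tuple (solSpace L) y i))).2]
  · intro y _
    refine le_of_eq ?_
    have : ∀ i, 1 - 1 / 2 * (1 + η * wave χ φ θ (tuple (solSpace L) y i))
        = 1 / 2 * (1 + -η * wave χ φ θ (tuple (solSpace L) y i)) := fun i => by ring
    simp only [this, Finset.prod_mul_distrib, Finset.prod_const, Finset.card_univ,
      Fintype.card_fin]
    ring
  · rw [avg_const_mul, avg_add]
    exact hN₀ _ (le_max_right _ _)

/-- Uncommonness of a system with a variable that vanishes identically, from the leading term over
the label choices avoiding that variable. -/
theorem isUncommon_of_zero (hirr : ¬ IsRedundant L) (hφ : ∀ j s, φ j s 0 = 0) {d : ℕ}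
    (hd : 0 < d) {i₀ : Fin k} (hzero : ∀ w ∈ solSpace L, w i₀ = 0)
    (hlow : ∀ μ, Survives (solSpace L) χ φ μ → μ i₀ = none → μ ≠ (fun _ => none) →
      d ≤ (labelled μ).card)
    (hlead : ∃ μ, Survives (solSpace L) χ φ μ ∧ μ i₀ = none ∧ (labelled μ).card = d)
    (hbal : ∀ μ, Survives (solSpace L) χ φ μ → μ i₀ = none → (labelled μ).card = d →
      ∃ j, ∑ i, charge j (μ i) ≠ 0) :
    IsUncommon L := by
  classical
  have : NeZero k := ⟨fun h => by subst h; exact i₀.elim0⟩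
  obtain ⟨θ, hθ⟩ := exists_shift_eventually_lt_one
    (Finset.univ.filter fun μ : Fin k → Option (J × ℤˣ) =>
      Survives (solSpace L) χ φ μ ∧ μ i₀ = none) hd
    (fun μ hμ => hlow μ (Finset.mem_filter.1 hμ).2.1 (Finset.mem_filter.1 hμ).2.2)
    (by
      obtain ⟨μ, hμ, hμ0, hμd⟩ := hlead
      exact ⟨μ, by simp [hμ, hμ0], hμd⟩)
    (fun μ hμ => hbal μ (Finset.mem_filter.1 hμ).2.1 (Finset.mem_filter.1 hμ).2.2)
  obtain ⟨η, hη, hη0, hη1⟩ := (hθ.and (exists_pos_small (2 * Fintype.card J))).exists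
  set l := ∑ μ : Fin k → Option (J × ℤˣ) with (Survives (solSpace L) χ φ μ ∧ μ i₀ = none),
    η ^ (labelled μ).card * (ZMod.stdAddChar (∑ i, shift θ (μ i)) : ℂ).re with hl
  -- Amplitude zero at `i₀` removes exactly the label choices that use `i₀`.
  set κ : Fin k → ℝ := fun i => if i = i₀ then 0 else η with hκ
  have hlim := (tendsto_avg_prod_wave (solSpace L) χ hφ θ κ).const_mul (2 * (1 / 2 : ℝ) ^ k)
  have hval : (∑ μ : Fin k → Option (J × ℤˣ) with Survives (solSpace L) χ φ μ,
        (∏ i, coeff (κ i) (μ i)) * (ZMod.stdAddChar (∑ i, shift θ (μ i)) : ℂ).re) = l := by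
    rw [hl, ← Finset.filter_filter, Finset.sum_filter (p := fun μ : Fin k → Option (J × ℤˣ) => μ i₀ = none)]
    refine Finset.sum_congr rfl fun μ _ => ?_
    split_ifs with he
    · rw [← prod_coeff_const]
      congr 1
      refine Finset.prod_congr rfl fun i _ => ?_
      by_cases hi : i = i₀
      · rw [hi, he]
        rfl
      · simp [hκ, hi]
    · obtain ⟨p, hp⟩ := Option.ne_none_iff_exists'.1 he
      rw [Finset.prod_eq_zero (Finset.mem_univ i₀), zero_mul]
      simp [hκ, hp, coeff]
  rw [hval] at hlim
  have hpos : (0 : ℝ) < (1 / 2) ^ k := by positivity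
  have hev := hlim.eventually_le_const
    (show 2 * (1 / 2 : ℝ) ^ k * l < 2 * (1 / 2 : ℝ) ^ k - (1 / 2) ^ k * (1 - l) by
      nlinarith)
  obtain ⟨N₀, hN₀⟩ := Filter.eventually_atTop.1 hev
  have hκw : ∀ i, ∀ {M : ℕ} (v : Fin (M * 3) → F), 0 ≤ 1 + κ i * wave χ φ θ v := by
    intro i M v
    by_cases hi : i = i₀
    · simp [hκ, hi]
    · simp only [hκ, hi, if_false]
      linarith [(abs_le.1 (abs_mul_wave_le (χ := χ) (φ := φ) (θ := θ) hη0 hη1 v)).1]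
  refine isUncommon_of_density L hirr (δ := (1 / 2) ^ k * (1 - l))
    (mul_pos hpos (by linarith)) fun N => ?_
  -- With `h 0 = 1`, the product of the `1 - h` vanishes because the entry at `i₀` is `0`. That
  -- entry contributes `1 = 2 * (1 / 2)` to the other product, whence the factor `2`; by injectivity
  -- no other entry is `0`.
  refine ⟨max N N₀ * 3, by omega,
    fun v => if v = 0 then 1 else (1 / 2) * (1 + η * wave χ φ θ v),
    fun x => 2 * (1 / 2 : ℝ) ^ k * ∏ i, (1 + κ i * wave χ φ θ (x i)), ?_, ?_, ?_, ?_, ?_⟩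
  · intro v
    dsimp only
    split_ifs
    · norm_num
    · linarith [(abs_le.1 (abs_mul_wave_le (χ := χ) (φ := φ) (θ := θ) hη0 hη1 v)).1]
  · intro v
    dsimp only
    split_ifs
    · norm_num
    · linarith [(abs_le.1 (abs_mul_wave_le (χ := χ) (φ := φ) (θ := θ) hη0 hη1 v)).2]
  · intro y
    exact mul_nonneg (by positivity) (Finset.prod_nonneg fun i _ => hκw i _)
  · intro y hy
    refine le_of_eq ?_
    have h0 : tuple (solSpace L) y i₀ = 0 := funext fun t => hzero _ (y t).2
    have hne : ∀ i, i ≠ i₀ → tuple (solSpace L) y i ≠ 0 := fun i hi h =>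
      hi (hy (h.trans h0.symm))
    have h2 : (1 / 2 : ℝ) ^ k = ∏ _i : Fin k, (1 / 2 : ℝ) := by simp
    rw [Finset.prod_eq_zero (f := fun j => 1 - _) (Finset.mem_univ i₀) (by simp [h0]), add_zero]
    dsimp only
    rw [h2, mul_assoc, ← Finset.prod_mul_distrib, ← Finset.mul_prod_erase _ _ (Finset.mem_univ i₀),
      ← Finset.mul_prod_erase _ (fun i => 1 / 2 * (1 + κ i * _)) (Finset.mem_univ i₀), ← mul_assoc]
    congr 1
    · simp [h0, hκ]
    · refine Finset.prod_congr rfl fun i hi => ?_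
      have hi' := (Finset.mem_erase.1 hi).1
      simp [hne i hi', hκ, hi']
  · rw [avg_const_mul]
    exact hN₀ _ (le_max_right _ _)

end Criteria

/-! ### Combinatorics of labels and balanced choices. -/

section Labels

variable {ι J : Type*} [Fintype ι] [DecidableEq J]

lemma sum_eq_sum_labelled {M : Type*} [AddCommMonoid M] (μ : ι → Option (J × ℤˣ))
    (g : ι → Option (J × ℤˣ) → M) (hg : ∀ i, g i none = 0) :
    ∑ i, g i (μ i) = ∑ i ∈ labelled μ, g i (μ i) := by
  refine (Finset.sum_subset (Finset.subset_univ _) fun i _ hi => ?_).symm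
  have : μ i = none := by simpa [labelled] using hi
  rw [this, hg]

lemma exists_label {μ : ι → Option (J × ℤˣ)} {i : ι} (hi : i ∈ labelled μ) :
    ∃ j e, μ i = some (j, e) := by
  obtain ⟨⟨j, e⟩, h⟩ := Option.isSome_iff_exists.1 (Finset.mem_filter.1 hi).2
  exact ⟨j, e, h⟩

lemma labelled_card_pos {μ : ι → Option (J × ℤˣ)} (h : μ ≠ fun _ => none) :
    0 < (labelled μ).card := by
  obtain ⟨i, hi⟩ := Function.ne_iff.1 h
  exact Finset.card_pos.2 ⟨i, by simpa [labelled, Option.isSome_iff_ne_none] using hi⟩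

/-- The label choice that puts the label `(j, 1)` on `τ j`. -/
noncomputable def labelAlong (τ : J ↪ ι) : ι → Option (J × ℤˣ) :=
  Function.extend τ (fun j => some (j, 1)) fun _ => none

lemma labelAlong_apply {ι J : Type*} (τ : J ↪ ι) (j : J) : labelAlong τ (τ j) = some (j, 1) :=
  τ.injective.extend_apply _ _ _

lemma labelAlong_of_notMem {ι J : Type*} (τ : J ↪ ι) {i : ι} (h : i ∉ Set.range τ) : labelAlong τ i = none :=
  Function.extend_apply' _ _ _ h

lemma card_labelled_labelAlong [Fintype J] (τ : J ↪ ι) :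
    (labelled (labelAlong τ)).card = Fintype.card J := by
  have : labelled (labelAlong τ) = Finset.univ.map τ := by
    ext i
    by_cases h : i ∈ Set.range τ
    · obtain ⟨j, rfl⟩ := h
      simp [labelled, labelAlong_apply]
    · simpa [labelled, labelAlong_of_notMem τ h] using h
  rw [this, Finset.card_map, Finset.card_univ]

lemma sum_phase_labelAlong {F ι J : Type*} [Field F] [Fintype ι] [Fintype J] (φ : J → Fin 3 → F → F) (τ : J ↪ ι)
    (s : Fin 3) (w : ι → F) :
    ∑ i, phase φ (labelAlong τ i) s (w i) = ∑ j, φ j s (w (τ j)) := by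
  refine (Fintype.sum_of_injective τ τ.injective _ _ (fun i hi => ?_) fun j => ?_).symm
  · rw [labelAlong_of_notMem τ hi]
    rfl
  · rw [labelAlong_apply]
    simp [phase]

lemma pairing_of_charge_two {j₁ j₂ : J} {e₁ e₂ : ℤˣ}
    (h : ∀ j, charge j (some (j₁, e₁)) + charge j (some (j₂, e₂)) = 0) :
    j₁ = j₂ ∧ e₂ = -e₁ := by
  have h1 := h j₁
  simp only [charge, if_true] at h1
  by_cases hj : j₂ = j₁
  · rw [if_pos hj] at h1
    refine ⟨hj.symm, ?_⟩
    clear h hj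
    revert e₁ e₂
    decide
  · rw [if_neg hj] at h1
    exfalso
    clear h hj
    revert e₁
    decide

/-- A sum of at most four signs lies between `-4` and `4`, so it vanishes mod 5 only if it vanishes:
this is why the shifts live in `ZMod 5`. Hence the first label has an opposite partner, and the
other two labels cancel each other. -/
lemma pairing_of_charge_four {j₁ j₂ j₃ j₄ : J} {e₁ e₂ e₃ e₄ : ℤˣ}
    (h : ∀ j, charge j (some (j₁, e₁)) + charge j (some (j₂, e₂)) + charge j (some (j₃, e₃)) +
      charge j (some (j₄, e₄)) = 0) :
    (j₁ = j₂ ∧ e₂ = -e₁ ∧ j₃ = j₄ ∧ e₄ = -e₃) ∨ (j₁ = j₃ ∧ e₃ = -e₁ ∧ j₂ = j₄ ∧ e₄ = -e₂) ∨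
      (j₁ = j₄ ∧ e₄ = -e₁ ∧ j₂ = j₃ ∧ e₃ = -e₂) := by
  have key : (j₂ = j₁ ∧ e₂ = -e₁) ∨ (j₃ = j₁ ∧ e₃ = -e₁) ∨ (j₄ = j₁ ∧ e₄ = -e₁) := by
    have h1 := h j₁
    simp only [charge, if_true] at h1
    by_cases h2 : j₂ = j₁ <;> by_cases h3 : j₃ = j₁ <;> by_cases h4 : j₄ = j₁ <;>
      simp only [h2, h3, h4, if_true, if_false, true_and, false_and, or_false, false_or] at h1 ⊢ <;>
      clear h h2 h3 h4 <;> revert e₁ e₂ e₃ e₄ <;> decide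
  rcases key with ⟨rfl, rfl⟩ | ⟨rfl, rfl⟩ | ⟨rfl, rfl⟩
  · have := pairing_of_charge_two (j₁ := j₃) (j₂ := j₄) (e₁ := e₃) (e₂ := e₄) fun j => by
      rw [← h j]
      simp only [charge]
      split_ifs <;> push_cast <;> ring
    simp [this]
  · have := pairing_of_charge_two (j₁ := j₂) (j₂ := j₄) (e₁ := e₂) (e₂ := e₄) fun j => by
      rw [← h j]
      simp only [charge]
      split_ifs <;> push_cast <;> ring
    simp [this]
  · have := pairing_of_charge_two (j₁ := j₂) (j₂ := j₃) (e₁ := e₂) (e₂ := e₃) fun j => by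
      rw [← h j]
      simp only [charge]
      split_ifs <;> push_cast <;> ring
    simp [this]

/-- The charges summed over all `j` give a sum of three signs, which is `±1` or `±3`, hence nonzero
mod 5. -/
lemma exists_charge_ne_zero_of_card_three [Fintype J] {μ : ι → Option (J × ℤˣ)}
    (h : (labelled μ).card = 3) : ∃ j, ∑ i, charge j (μ i) ≠ 0 := by
  classical
  by_contra! hcon
  have h0 : ∑ j, ∑ i, charge j (μ i) = 0 := Finset.sum_eq_zero fun j _ => hcon j
  rw [Finset.sum_comm, sum_eq_sum_labelled μ (fun _ o => ∑ j, charge j o) (by simp [charge])] at h0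
  obtain ⟨a, b, c, hab, hac, hbc, hμ⟩ := Finset.card_eq_three.1 h
  obtain ⟨j₁, e₁, h1⟩ := exists_label (μ := μ) (i := a) (by simp [hμ])
  obtain ⟨j₂, e₂, h2⟩ := exists_label (μ := μ) (i := b) (by simp [hμ])
  obtain ⟨j₃, e₃, h3⟩ := exists_label (μ := μ) (i := c) (by simp [hμ])
  rw [hμ, Finset.sum_insert (by simp [hab, hac]), Finset.sum_pair hbc, h1, h2, h3] at h0
  simp only [charge, Finset.sum_ite_eq, Finset.mem_univ, if_true] at h0
  clear * - h0
  revert e₁ e₂ e₃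
  decide

end Labels

/-! ### From trivial characters to vanishing forms. -/

section Characters

variable {F : Type*} [Field F] {ι : Type*} {χ : AddChar F ℂ} {K : Submodule F (ι → F)}

lemma eq_zero_of_char_mul (hχ : χ.IsPrimitive) {u : F} (h : ∀ c, χ (c * u) = 1) : u = 0 := by
  by_contra hu
  refine hχ hu (DFunLike.ext _ _ fun c => ?_)
  rw [AddChar.mulShift_apply, mul_comm, h]
  rfl

lemma eq_zero_of_char_linear (hχ : χ.IsPrimitive) {l : (ι → F) → F}
    (hl : ∀ c w, l (c • w) = c * l w) (h : ∀ w ∈ K, χ (l w) = 1) : ∀ w ∈ K, l w = 0 := by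
  intro w hw
  refine eq_zero_of_char_mul hχ fun c => ?_
  rw [← hl]
  exact h _ (K.smul_mem c hw)

lemma eq_zero_of_char_quadratic (hχ : χ.IsPrimitive) (h2 : (2 : F) ≠ 0) {l : (ι → F) → F}
    (hl : ∀ c w, l (c • w) = c ^ 2 * l w) (h : ∀ w ∈ K, χ (l w) = 1) : ∀ w ∈ K, l w = 0 := by
  intro w hw
  have hsq : ∀ c, χ (c ^ 2 * l w) = 1 := fun c => by
    rw [← hl]
    exact h _ (K.smul_mem c hw)
  refine eq_zero_of_char_mul hχ fun c => ?_
  -- Since `2` is invertible, every `c` is a difference of two squares.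
  have : c * l w = ((c / 2 + 1 / 2) ^ 2 * l w) - (c / 2 - 1 / 2) ^ 2 * l w := by
    field_simp
    ring
  rw [this, AddChar.map_sub_eq_div, hsq, hsq, div_one]

end Characters

/-! ### Small surviving label choices in an irredundant system. -/

section Cases

variable {F : Type*} [Field F] {m k : ℕ} {L : Matrix (Fin m) (Fin k) F} {χ : AddChar F ℂ}

lemma unit_cast_ne_zero (e : ℤˣ) : ((e : ℤ) : F) ≠ 0 := by
  rcases Int.units_eq_one_or e with rfl | rfl <;> simp

lemma exists_ne_of_irredundant (hirr : ¬ IsRedundant L) {i j : Fin k} (hij : i ≠ j) :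
    ∃ w ∈ solSpace L, w i ≠ w j := by
  by_contra! h
  exact hirr (isRedundant_of_eq L hij h)

variable {J : Type*} [DecidableEq J]

lemma sum_phase_of_pair {φ : J → Fin 3 → F → F} {μ : Fin k → Option (J × ℤˣ)} {a b : Fin k}
    (hab : a ≠ b) (hμ : labelled μ = {a, b}) (s : Fin 3) (w : Fin k → F) :
    ∑ i, phase φ (μ i) s (w i) = phase φ (μ a) s (w a) + phase φ (μ b) s (w b) := by
  rw [sum_eq_sum_labelled μ (fun i o => phase φ o s (w i)) (fun _ => rfl), hμ,
    Finset.sum_pair hab]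

/-- With linear phases `A s j * w`, a surviving pair of labels gives a linear relation between two
variables. -/
lemma relation_of_survives_pair (hχ : χ.IsPrimitive) {φ : J → Fin 3 → F → F} {s : Fin 3} {A : J → F}
    (hφ : ∀ j w, φ j s w = A j * w) {μ : Fin k → Option (J × ℤˣ)}
    (hsur : Survives (solSpace L) χ φ μ) {a b : Fin k} (hab : a ≠ b) (hμ : labelled μ = {a, b}) :
    ∃ j₁ e₁ j₂ e₂, μ a = some (j₁, e₁) ∧ μ b = some (j₂, e₂) ∧
      ∀ w ∈ solSpace L, ((e₁ : ℤ) : F) * A j₁ * w a + ((e₂ : ℤ) : F) * A j₂ * w b = 0 := by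
  obtain ⟨j₁, e₁, h1⟩ := exists_label (μ := μ) (i := a) (by simp [hμ])
  obtain ⟨j₂, e₂, h2⟩ := exists_label (μ := μ) (i := b) (by simp [hμ])
  refine ⟨j₁, e₁, j₂, e₂, h1, h2, eq_zero_of_char_linear hχ (fun c w => ?_) fun w hw => ?_⟩
  · simp only [Pi.smul_apply, smul_eq_mul]
    ring
  · have := hsur s w hw
    rw [sum_phase_of_pair hab hμ, h1, h2] at this
    simpa only [phase, hφ, mul_assoc] using this

/-- A balanced pair carries labels `(j, e)` and `(j, -e)`, so survival would make its two variables
equal on all solutions. -/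
lemma exists_charge_ne_zero_of_card_two (hχ : χ.IsPrimitive) (hirr : ¬ IsRedundant L)
    {φ : J → Fin 3 → F → F} {s : Fin 3} {A : J → F} (hφ : ∀ j w, φ j s w = A j * w)
    (hA : ∀ j, A j ≠ 0) {μ : Fin k → Option (J × ℤˣ)} (hsur : Survives (solSpace L) χ φ μ)
    (hcard : (labelled μ).card = 2) : ∃ j, ∑ i, charge j (μ i) ≠ 0 := by
  by_contra! hcon
  obtain ⟨a, b, hab, hμ⟩ := Finset.card_eq_two.1 hcard
  obtain ⟨j₁, e₁, j₂, e₂, h1, h2, hrel⟩ := relation_of_survives_pair hχ hφ hsur hab hμ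
  obtain ⟨rfl, rfl⟩ := pairing_of_charge_two (j₁ := j₁) (j₂ := j₂) (e₁ := e₁) (e₂ := e₂) fun j => by
    rw [← hcon j, sum_eq_sum_labelled μ (fun _ o => charge j o) (fun _ => rfl), hμ,
      Finset.sum_pair hab, h1, h2]
  obtain ⟨w, hw, hne⟩ := exists_ne_of_irredundant hirr hab
  have := hrel w hw
  push_cast at this
  have h3 : ((e₁ : ℤ) : F) * A j₁ * (w a - w b) = 0 := by linear_combination this
  exact hne (sub_eq_zero.1 ((mul_eq_zero.1 h3).resolve_left
    (mul_ne_zero (unit_cast_ne_zero e₁) (hA j₁))))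

/-- With linear phases, a surviving single label forces its variable to vanish. -/
lemma card_labelled_ne_one (hχ : χ.IsPrimitive) (hirr : ¬ IsRedundant L)
    {φ : J → Fin 3 → F → F} {s : Fin 3} {A : J → F} (hφ : ∀ j w, φ j s w = A j * w)
    (hA : ∀ j, A j ≠ 0) {μ : Fin k → Option (J × ℤˣ)} (hsur : Survives (solSpace L) χ φ μ)
    {i₀ : Fin k} (hzero : ∀ w ∈ solSpace L, w i₀ = 0) (hi₀ : μ i₀ = none) :
    (labelled μ).card ≠ 1 := by
  intro hcard
  obtain ⟨a, hμ⟩ := Finset.card_eq_one.1 hcard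
  obtain ⟨j, e, h1⟩ := exists_label (μ := μ) (i := a) (by simp [hμ])
  have hne : a ≠ i₀ := by
    rintro rfl
    simp [h1] at hi₀
  have hrel : ∀ w ∈ solSpace L, ((e : ℤ) : F) * A j * w a = 0 := by
    refine eq_zero_of_char_linear hχ (fun c w => ?_) fun w hw => ?_
    · simp only [Pi.smul_apply, smul_eq_mul]
      ring
    · have := hsur s w hw
      rw [sum_eq_sum_labelled μ (fun i o => phase φ o s (w i)) (fun _ => rfl), hμ,
        Finset.sum_singleton, h1] at this
      simpa only [phase, hφ, mul_assoc] using this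
  obtain ⟨w, hw, hw'⟩ := exists_ne_of_irredundant hirr hne
  rw [hzero w hw] at hw'
  exact mul_ne_zero (mul_ne_zero (unit_cast_ne_zero e) (hA j)) hw' (hrel w hw)

/-- With phases that are linear in the first two coordinates and quadratic in the third, four
surviving labels do not cancel in pairs. -/
lemma no_surviving_pairing (hχ : χ.IsPrimitive) (h2 : (2 : F) ≠ 0) (hirr : ¬ IsRedundant L)
    {A B C : J → F} (hD : ∀ j j', j ≠ j' → A j * B j' - B j * A j' ≠ 0)
    (hA : ∀ j, A j ≠ 0 ∨ B j ≠ 0) (hC : ∀ j, C j ≠ 0)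
    {a b c d : Fin k} (hab : a ≠ b) (hbc : b ≠ c) (hbd : b ≠ d)
    {j j' : J} {e e' : ℤˣ}
    (h0 : ∀ w ∈ solSpace L, χ ((e : ℤ) * (A j * w a) + ((-e : ℤˣ) : ℤ) * (A j * w b) +
      (e' : ℤ) * (A j' * w c) + ((-e' : ℤˣ) : ℤ) * (A j' * w d)) = 1)
    (h1 : ∀ w ∈ solSpace L, χ ((e : ℤ) * (B j * w a) + ((-e : ℤˣ) : ℤ) * (B j * w b) +
      (e' : ℤ) * (B j' * w c) + ((-e' : ℤˣ) : ℤ) * (B j' * w d)) = 1)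
    (hq : ∀ w ∈ solSpace L, χ ((e : ℤ) * (C j * w a ^ 2) + ((-e : ℤˣ) : ℤ) * (C j * w b ^ 2) +
      (e' : ℤ) * (C j' * w c ^ 2) + ((-e' : ℤˣ) : ℤ) * (C j' * w d ^ 2)) = 1) : False := by
  have h0' := eq_zero_of_char_linear hχ (fun c w => by
    simp only [Pi.smul_apply, smul_eq_mul]; ring) h0
  have h1' := eq_zero_of_char_linear hχ (fun c w => by
    simp only [Pi.smul_apply, smul_eq_mul]; ring) h1
  have hq' := eq_zero_of_char_quadratic hχ h2 (fun c w => by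
    simp only [Pi.smul_apply, smul_eq_mul]; ring) hq
  push_cast at h0' h1' hq'
  have he := unit_cast_ne_zero (F := F) e
  by_cases hj : j = j'
  · subst hj
    have hlin : ∀ w ∈ solSpace L,
        ((e : ℤ) : F) * (w a - w b) + ((e' : ℤ) : F) * (w c - w d) = 0 := by
      intro w hw
      rcases hA j with h | h
      · refine (mul_eq_zero.1 (?_ : A j * _ = 0)).resolve_left h
        linear_combination h0' w hw
      · refine (mul_eq_zero.1 (?_ : B j * _ = 0)).resolve_left h
        linear_combination h1' w hw
    have hquad : ∀ w ∈ solSpace L,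
        ((e : ℤ) : F) * (w a ^ 2 - w b ^ 2) + ((e' : ℤ) : F) * (w c ^ 2 - w d ^ 2) = 0 := by
      intro w hw
      refine (mul_eq_zero.1 (?_ : C j * _ = 0)).resolve_left (hC j)
      linear_combination hq' w hw
    -- Substituting the linear relation into the differences of squares leaves `2 * (w a - w b) * (w
    -- b - w f)` up to sign, with `f = c` if the signs `e`, `e'` agree and `f = d` otherwise.
    obtain ⟨f, hbf, hprod⟩ : ∃ f, b ≠ f ∧ ∀ w ∈ solSpace L, (w a - w b) * (w b - w f) = 0 := by
      rcases Int.units_eq_one_or e with rfl | rfl <;> rcases Int.units_eq_one_or e' with rfl | rfl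
      · refine ⟨c, hbc, fun w hw => (mul_eq_zero.1 (?_ : (2 : F) * _ = 0)).resolve_left h2⟩
        have hl := hlin w hw
        have hqq := hquad w hw
        push_cast at hl hqq
        linear_combination hqq - (w d + w a - w b + w c) * hl
      · refine ⟨d, hbd, fun w hw => (mul_eq_zero.1 (?_ : (2 : F) * _ = 0)).resolve_left h2⟩
        have hl := hlin w hw
        have hqq := hquad w hw
        push_cast at hl hqq
        linear_combination hqq - (w c + w a - w b + w d) * hl
      · refine ⟨d, hbd, fun w hw => (mul_eq_zero.1 (?_ : (2 : F) * _ = 0)).resolve_left h2⟩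
        have hl := hlin w hw
        have hqq := hquad w hw
        push_cast at hl hqq
        linear_combination -hqq + (w c + w a - w b + w d) * hl
      · refine ⟨c, hbc, fun w hw => (mul_eq_zero.1 (?_ : (2 : F) * _ = 0)).resolve_left h2⟩
        have hl := hlin w hw
        have hqq := hquad w hw
        push_cast at hl hqq
        linear_combination -hqq + (w d + w a - w b + w c) * hl
    -- A vector space is not the union of two proper subspaces: with `u` off the first kernel and
    -- `v` off the second, the product is nonzero at `u + v`.
    obtain ⟨u, hu, hune⟩ := exists_ne_of_irredundant hirr hab
    obtain ⟨v, hv, hvne⟩ := exists_ne_of_irredundant hirr hbf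
    have hu2 := (mul_eq_zero.1 (hprod u hu)).resolve_left (sub_ne_zero.2 hune)
    have hv2 := (mul_eq_zero.1 (hprod v hv)).resolve_right (sub_ne_zero.2 hvne)
    have huv := hprod (u + v) (add_mem hu hv)
    simp only [Pi.add_apply] at huv
    have : (u a - u b) * (v b - v f) = 0 := by
      linear_combination huv - (u a - u b + (v a - v b)) * hu2 - (v b - v f) * hv2
    exact mul_ne_zero (sub_ne_zero.2 hune) (sub_ne_zero.2 hvne) this
  -- For `j ≠ j'` the two linear relations have nonzero determinant; eliminating `w c - w d` forces
  -- `w a = w b`.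
  · obtain ⟨w, hw, hne⟩ := exists_ne_of_irredundant hirr hab
    have : ((e : ℤ) : F) * (A j * B j' - B j * A j') * (w a - w b) = 0 := by
      linear_combination B j' * h0' w hw - A j' * h1' w hw
    exact mul_ne_zero (mul_ne_zero he (hD j j' hj)) (sub_ne_zero.2 hne) this

end Cases

/-! ### The three kinds of induced relation. -/

section Main

lemma sum_eq_of_four {ι J M : Type*} [Fintype ι] [DecidableEq ι] [DecidableEq J] [AddCommMonoid M]
    {μ : ι → Option (J × ℤˣ)} {a b c d : ι} (hab : a ≠ b) (hac : a ≠ c) (had : a ≠ d) (hbc : b ≠ c)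
    (hbd : b ≠ d) (hcd : c ≠ d) (hμ : labelled μ = {a, b, c, d}) (g : ι → Option (J × ℤˣ) → M)
    (hg : ∀ i, g i none = 0) :
    ∑ i, g i (μ i) = g a (μ a) + g b (μ b) + g c (μ c) + g d (μ d) := by
  rw [sum_eq_sum_labelled μ g hg, hμ, Finset.sum_insert (by simp [hab, hac, had]),
    Finset.sum_insert (by simp [hbc, hbd]), Finset.sum_pair hcd]
  simp only [add_assoc]

variable {F : Type*} [Field F] {m k : ℕ} {L : Matrix (Fin m) (Fin k) F}

/-- An irredundant system inducing an equation in two variables is uncommon. -/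
theorem isUncommon_of_pair [Fintype F] (hirr : ¬ IsRedundant L) {τ : Fin 2 ↪ Fin k} {b : Fin 2 → F}
    (hb : ∀ j, b j ≠ 0) (hrel : ∀ w ∈ solSpace L, ∑ j, b j * w (τ j) = 0) : IsUncommon L := by
  have hχ := AddChar.FiniteField.primitiveChar_to_Complex_isPrimitive (F := F)
  set χ := AddChar.FiniteField.primitiveChar_to_Complex F
  set φ : Fin 2 → Fin 3 → F → F := fun j _ w => b j * w with hφdef
  have hφ : ∀ j w, φ j 0 w = b j * w := fun _ _ => rfl
  have hφ0 : ∀ j s, φ j s 0 = 0 := fun _ _ => mul_zero _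
  have hlead : Survives (solSpace L) χ φ (labelAlong τ) := fun s w hw => by
    rw [sum_phase_labelAlong, hrel w hw, AddChar.map_zero_eq_one]
  have hcard : (labelled (labelAlong τ)).card = 2 := by
    simpa using card_labelled_labelAlong τ
  by_cases hz : ∃ i₀, ∀ w ∈ solSpace L, w i₀ = 0
  · obtain ⟨i₀, hzero⟩ := hz
    refine isUncommon_of_zero (χ := χ) hirr hφ0 two_pos hzero (fun μ hsur hμ0 hne => ?_)
      ⟨_, hlead, ?_, hcard⟩
      fun μ hsur _ hc => exists_charge_ne_zero_of_card_two hχ hirr hφ hb hsur hc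
    · have h1 := card_labelled_ne_one hχ hirr hφ hb hsur hzero hμ0
      have h2 := labelled_card_pos hne
      omega
    -- If the equation involved the vanishing variable, its other variable would vanish too, and the
    -- two would be equal.
    · refine labelAlong_of_notMem τ ?_
      rintro ⟨j, hj⟩
      have hne : τ (j + 1) ≠ τ j := fun h => by
        have := τ.injective h
        revert this
        clear * -
        revert j
        decide
      obtain ⟨w, hw, hw'⟩ := exists_ne_of_irredundant hirr hne
      have hwj : w (τ j) = 0 := hj ▸ hzero w hw
      have := hrel w hw
      have hall : ∀ c, ¬ (c ≠ j + 1 ∧ c ≠ j) := by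
        clear * -
        revert j
        decide
      rw [Fintype.sum_eq_add (j + 1) j (fun h => hne (congrArg τ h))
        (fun c hc => absurd hc (hall c)), hwj, mul_zero, add_zero] at this
      exact hw' (((mul_eq_zero.1 this).resolve_left (hb _)).trans hwj.symm)
  · have : NeZero k := ⟨fun h => by subst h; exact (τ 0).elim0⟩
    refine isUncommon_of_even (χ := χ) hirr hφ0 two_pos even_two (fun μ _ hev hne => ?_)
      ⟨_, hlead, hcard⟩
      fun μ hsur hc => exists_charge_ne_zero_of_card_two hχ hirr hφ hb hsur hc
    have h2 := labelled_card_pos hne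
    obtain ⟨r, hr⟩ := hev
    omega

/-- An irredundant system with a vanishing variable that induces an equation in three further
variables, and none in two variables, is uncommon. -/
theorem isUncommon_of_triple [Fintype F] (hirr : ¬ IsRedundant L)
    (hnp : ∀ i j, i ≠ j → ∀ b b' : F, b ≠ 0 → b' ≠ 0 → ∃ w ∈ solSpace L, b * w i + b' * w j ≠ 0)
    {i₀ : Fin k} (hzero : ∀ w ∈ solSpace L, w i₀ = 0)
    {τ : Fin 3 ↪ Fin k} (hτ : ∀ j, τ j ≠ i₀) {b : Fin 3 → F}
    (hb : ∀ j, b j ≠ 0) (hrel : ∀ w ∈ solSpace L, ∑ j, b j * w (τ j) = 0) : IsUncommon L := by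
  have hχ := AddChar.FiniteField.primitiveChar_to_Complex_isPrimitive (F := F)
  set χ := AddChar.FiniteField.primitiveChar_to_Complex F
  set φ : Fin 3 → Fin 3 → F → F := fun j _ w => b j * w with hφdef
  have hφ : ∀ j w, φ j 0 w = b j * w := fun _ _ => rfl
  refine isUncommon_of_zero (χ := χ) (φ := φ) hirr (fun _ _ => mul_zero _) three_pos hzero
    (fun μ hsur hμ0 hne => ?_) ⟨labelAlong τ, fun s w hw => ?_, ?_, ?_⟩
    fun μ _ _ hc => exists_charge_ne_zero_of_card_three hc
  · have h1 := card_labelled_ne_one hχ hirr hφ hb hsur hzero hμ0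
    have h2 := labelled_card_pos hne
    have h3 : (labelled μ).card ≠ 2 := fun h => by
      obtain ⟨a, c, hac, hμ⟩ := Finset.card_eq_two.1 h
      obtain ⟨j₁, e₁, j₂, e₂, -, -, h⟩ := relation_of_survives_pair hχ hφ hsur hac hμ
      obtain ⟨w, hw, hw'⟩ := hnp a c hac _ _ (mul_ne_zero (unit_cast_ne_zero e₁) (hb j₁))
        (mul_ne_zero (unit_cast_ne_zero e₂) (hb j₂))
      exact hw' (h w hw)
    omega
  · rw [sum_phase_labelAlong, hrel w hw, AddChar.map_zero_eq_one]
  · exact labelAlong_of_notMem τ fun ⟨j, hj⟩ => hτ j hj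
  · simpa using card_labelled_labelAlong τ

/-- The determinant of the columns `i` and `j` of a matrix with two rows. -/
def minor (M : Matrix (Fin 2) (Fin 4) F) (i j : Fin 4) : F := M 0 i * M 1 j - M 1 i * M 0 j

/-- The coefficients of the quadratic relation between four linear forms in two variables. -/
def quadCoeff (M : Matrix (Fin 2) (Fin 4) F) : Fin 4 → F :=
  ![minor M 0 1 * minor M 0 2 * minor M 0 3, minor M 1 0 * minor M 1 2 * minor M 1 3,
    minor M 2 0 * minor M 2 1 * minor M 2 3, minor M 3 0 * minor M 3 1 * minor M 3 2]

lemma quadCoeff_ne_zero {M : Matrix (Fin 2) (Fin 4) F} (hM : ∀ i j, i ≠ j → minor M i j ≠ 0)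
    (j : Fin 4) : quadCoeff M j ≠ 0 := by
  fin_cases j <;>
    exact mul_ne_zero (mul_ne_zero (hM _ _ (by decide)) (hM _ _ (by decide))) (hM _ _ (by decide))

/-- The solutions `u` of `M` form a plane, on which quadratic forms have dimension three, so the
four squares are dependent. Explicitly, the rows express `u 2` and `u 3` through `u 0` and `u 1`, up
to the factor `minor M 2 3`, and an identity in `u 0`, `u 1` remains. -/
lemma sum_quadCoeff_mul_sq {M : Matrix (Fin 2) (Fin 4) F} (hM : ∀ i j, i ≠ j → minor M i j ≠ 0)
    {u : Fin 4 → F} (h0 : ∑ j, M 0 j * u j = 0) (h1 : ∑ j, M 1 j * u j = 0) :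
    ∑ j, quadCoeff M j * u j ^ 2 = 0 := by
  refine (mul_eq_zero.1 (?_ : minor M 2 3 * _ = 0)).resolve_left (hM 2 3 (by decide))
  simp only [Fin.sum_univ_four] at h0 h1 ⊢
  have e2 : minor M 2 0 * u 0 + minor M 2 1 * u 1 + minor M 2 3 * u 3 = 0 := by
    simp only [minor]
    linear_combination M 0 2 * h1 - M 1 2 * h0
  have e3 : minor M 3 0 * u 0 + minor M 3 1 * u 1 + minor M 3 2 * u 2 = 0 := by
    simp only [minor]
    linear_combination M 0 3 * h1 - M 1 3 * h0
  change minor M 2 3 * (minor M 0 1 * minor M 0 2 * minor M 0 3 * u 0 ^ 2 +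
    minor M 1 0 * minor M 1 2 * minor M 1 3 * u 1 ^ 2 +
    minor M 2 0 * minor M 2 1 * minor M 2 3 * u 2 ^ 2 +
    minor M 3 0 * minor M 3 1 * minor M 3 2 * u 3 ^ 2) = 0
  have key : minor M 2 3 * (minor M 0 1 * minor M 0 2 * minor M 0 3 * u 0 ^ 2 +
      minor M 1 0 * minor M 1 2 * minor M 1 3 * u 1 ^ 2) +
      minor M 2 0 * minor M 2 1 * (minor M 3 0 * u 0 + minor M 3 1 * u 1) ^ 2 -
      minor M 3 0 * minor M 3 1 * (minor M 2 0 * u 0 + minor M 2 1 * u 1) ^ 2 = 0 := by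
    simp only [minor]
    ring
  have hanti : minor M 3 2 = - minor M 2 3 := by
    simp only [minor]
    ring
  rw [hanti] at e3 ⊢
  linear_combination key + minor M 2 0 * minor M 2 1 *
    (-minor M 2 3 * u 2 - (minor M 3 0 * u 0 + minor M 3 1 * u 1)) * e3 -
    minor M 3 0 * minor M 3 1 *
    (minor M 2 3 * u 3 - (minor M 2 0 * u 0 + minor M 2 1 * u 1)) * e2

/-- An irredundant system without equations in at most two variables that induces a system of two
equations in four variables with nonzero minors is uncommon. -/
theorem isUncommon_of_quad [Fintype F] (h2 : (2 : F) ≠ 0) (hirr : ¬ IsRedundant L)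
    (hnp : ∀ i j, i ≠ j → ∀ b b' : F, b ≠ 0 → ∃ w ∈ solSpace L, b * w i + b' * w j ≠ 0)
    {τ : Fin 4 ↪ Fin k} {M : Matrix (Fin 2) (Fin 4) F} (hM : ∀ i j, i ≠ j → minor M i j ≠ 0)
    (hrel : ∀ w ∈ solSpace L, ∀ s, ∑ j, M s j * w (τ j) = 0) : IsUncommon L := by
  have hχ := AddChar.FiniteField.primitiveChar_to_Complex_isPrimitive (F := F)
  set χ := AddChar.FiniteField.primitiveChar_to_Complex F
  have : NeZero k := ⟨fun h => by subst h; exact (τ 0).elim0⟩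
  -- The linear phases exclude survivors with two labels and balanced pairings with different `j`;
  -- the quadratic phase excludes pairings repeating one `j`.
  set φ : Fin 4 → Fin 3 → F → F := fun j => ![fun w => M 0 j * w, fun w => M 1 j * w,
    fun w => quadCoeff M j * w ^ 2] with hφdef
  have hφ0 : ∀ j w, φ j 0 w = M 0 j * w := fun _ _ => rfl
  have hφ1 : ∀ j w, φ j 1 w = M 1 j * w := fun _ _ => rfl
  have hφ2 : ∀ j w, φ j 2 w = quadCoeff M j * w ^ 2 := fun _ _ => rfl
  have hcol : ∀ j, M 0 j ≠ 0 ∨ M 1 j ≠ 0 := by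
    intro j
    by_contra! h
    refine hM j (j + 1) (by clear * -; revert j; decide) ?_
    simp [minor, h.1, h.2]
  refine isUncommon_of_even (χ := χ) (φ := φ) hirr (fun j s => ?_) four_pos (by decide)
    (fun μ hsur hev hne => ?_) ⟨labelAlong τ, fun s w hw => ?_, ?_⟩ fun μ hsur hc => ?_
  · fin_cases s <;> simp [hφdef]
  · have h1 := labelled_card_pos hne
    have h3 : (labelled μ).card ≠ 2 := fun h => by
      obtain ⟨a, b, hab, hμ⟩ := Finset.card_eq_two.1 h
      obtain ⟨j₁, e₁, ha⟩ := exists_label (μ := μ) (i := a) (by simp [hμ])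
      rcases hcol j₁ with hj | hj
      · obtain ⟨j₁', e₁', j₂, e₂, ha', -, h⟩ := relation_of_survives_pair hχ hφ0 hsur hab hμ
        obtain ⟨rfl, rfl⟩ : j₁ = j₁' ∧ e₁ = e₁' := by simpa using ha.symm.trans ha'
        obtain ⟨w, hw, hw'⟩ := hnp a b hab _ (((e₂ : ℤ) : F) * M 0 j₂)
          (mul_ne_zero (unit_cast_ne_zero e₁) hj)
        exact hw' (h w hw)
      · obtain ⟨j₁', e₁', j₂, e₂, ha', -, h⟩ := relation_of_survives_pair hχ hφ1 hsur hab hμ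
        obtain ⟨rfl, rfl⟩ : j₁ = j₁' ∧ e₁ = e₁' := by simpa using ha.symm.trans ha'
        obtain ⟨w, hw, hw'⟩ := hnp a b hab _ (((e₂ : ℤ) : F) * M 1 j₂)
          (mul_ne_zero (unit_cast_ne_zero e₁) hj)
        exact hw' (h w hw)
    obtain ⟨r, hr⟩ := hev
    omega
  · rw [sum_phase_labelAlong]
    convert AddChar.map_zero_eq_one χ
    fin_cases s
    · exact hrel w hw 0
    · exact hrel w hw 1
    · exact sum_quadCoeff_mul_sq hM (hrel w hw 0) (hrel w hw 1)
  · simpa using card_labelled_labelAlong τ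
  · by_contra! hcon
    obtain ⟨a, t, hat, hμ, htc⟩ := Finset.card_eq_succ.1 hc
    obtain ⟨b, c, d, hbc, hbd, hcd, rfl⟩ := Finset.card_eq_three.1 htc
    simp only [Finset.mem_insert, Finset.mem_singleton, not_or] at hat
    obtain ⟨hab, hac, had⟩ := hat
    obtain ⟨j₁, e₁, h₁⟩ := exists_label (μ := μ) (i := a) (by simp [← hμ])
    obtain ⟨j₂, e₂, h₂⟩ := exists_label (μ := μ) (i := b) (by simp [← hμ])
    obtain ⟨j₃, e₃, h₃⟩ := exists_label (μ := μ) (i := c) (by simp [← hμ])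
    obtain ⟨j₄, e₄, h₄⟩ := exists_label (μ := μ) (i := d) (by simp [← hμ])
    have hpair := pairing_of_charge_four (j₁ := j₁) (j₂ := j₂) (j₃ := j₃) (j₄ := j₄)
      (e₁ := e₁) (e₂ := e₂) (e₃ := e₃) (e₄ := e₄) fun j => by
        rw [← hcon j,
          sum_eq_of_four hab hac had hbc hbd hcd hμ.symm (fun _ o => charge j o) (fun _ => rfl), h₁, h₂, h₃, h₄]
    have hs : ∀ s, ∀ w ∈ solSpace L, χ (((e₁ : ℤ) : F) * φ j₁ s (w a) +
        ((e₂ : ℤ) : F) * φ j₂ s (w b) + ((e₃ : ℤ) : F) * φ j₃ s (w c) + ((e₄ : ℤ) : F) * φ j₄ s (w d)) = 1 := by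
      intro s w hw
      rw [← hsur s w hw,
        sum_eq_of_four hab hac had hbc hbd hcd hμ.symm (fun i o => phase φ o s (w i)) (fun _ => rfl), h₁, h₂, h₃, h₄]
      rfl
    rcases hpair with ⟨rfl, rfl, rfl, rfl⟩ | ⟨rfl, rfl, rfl, rfl⟩ | ⟨rfl, rfl, rfl, rfl⟩
    · exact no_surviving_pairing hχ h2 hirr hM hcol (quadCoeff_ne_zero hM) hab hbc hbd
        (hs 0) (hs 1) (hs 2)
    · refine no_surviving_pairing hχ h2 hirr hM hcol (quadCoeff_ne_zero hM) hac (Ne.symm hbc) hcd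
        (j := j₁) (j' := j₂) (e := e₁) (e' := e₂) (fun w hw => ?_) (fun w hw => ?_)
        fun w hw => ?_
      · rw [← hs 0 w hw]; congr 1; simp only [hφ0]; ring
      · rw [← hs 1 w hw]; congr 1; simp only [hφ1]; ring
      · rw [← hs 2 w hw]; congr 1; simp only [hφ2]; ring
    · refine no_surviving_pairing hχ h2 hirr hM hcol (quadCoeff_ne_zero hM) had (Ne.symm hbd)
        (Ne.symm hcd) (j := j₁) (j' := j₂) (e := e₁) (e' := e₂) (fun w hw => ?_)
        (fun w hw => ?_) fun w hw => ?_
      · rw [← hs 0 w hw]; congr 1; simp only [hφ0]; ring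
      · rw [← hs 1 w hw]; congr 1; simp only [hφ1]; ring
      · rw [← hs 2 w hw]; congr 1; simp only [hφ2]; ring

/-- A left kernel vector of the singular 2×2 block combines the rows into an equation without
variables `i` and `j`; it is nontrivial as the rows are independent. The case `i = j` is allowed and
eliminates a single variable. -/
lemma exists_relation_of_minor_eq_zero {M : Matrix (Fin 2) (Fin 4) F} (hM : IsSystem M)
    {i j : Fin 4} (hij : minor M i j = 0) :
    ∃ r : Fin 4 → F, r ≠ 0 ∧ r i = 0 ∧ r j = 0 ∧
      ∀ u : Fin 4 → F, M.mulVec u = 0 → ∑ t, r t * u t = 0 := by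
  have hdet : (M.submatrix id ![i, j]).det = 0 := by
    rw [Matrix.det_fin_two]
    simpa [minor, mul_comm] using hij
  obtain ⟨v, hv, hv0⟩ := Matrix.exists_vecMul_eq_zero_iff.2 hdet
  refine ⟨Matrix.vecMul v M, fun h => hv ?_, ?_, ?_, fun u hu => ?_⟩
  · exact Matrix.vecMul_injective_iff.2 hM (by simpa using h)
  · exact congrFun hv0 0
  · exact congrFun hv0 1
  · change dotProduct (Matrix.vecMul v M) u = 0
    rw [← Matrix.dotProduct_mulVec, hu, dotProduct_zero]

end Main

end LinSys

theorem theorem1p1 {F : Type*} [Field F] [Fintype F] (hq : Odd (Fintype.card F))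
    (m k : ℕ) (hm : 2 ≤ m) (hmk : m < k)
    (L : Matrix (Fin m) (Fin k) F) (hL : LinSys.IsSystem L) (hirr : ¬ LinSys.IsRedundant L)
    (hind : ∃ L' : Matrix (Fin 2) (Fin 4) F, LinSys.IsSystem L' ∧ LinSys.Induces L L') :
    LinSys.IsUncommon L := by
  open LinSys in
  have h2 : (2 : F) ≠ 0 := by
    apply Ring.two_ne_zero
    intro h
    rw [← Nat.not_even_iff_odd] at hq
    exact hq (Nat.even_iff.2 (FiniteField.even_card_of_char_two h))
  obtain ⟨M, hM, σ, hσ⟩ := hind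
  have hσ' : ∀ w ∈ solSpace L, M.mulVec (fun a => w (σ a)) = 0 := fun w hw =>
    hσ w ((mem_solSpace L).1 hw)
  by_cases hnp : ∀ i j, i ≠ j → ∀ b b' : F, b ≠ 0 → b' ≠ 0 →
      ∃ w ∈ solSpace L, b * w i + b' * w j ≠ 0
  swap
  · push Not at hnp
    obtain ⟨i, j, hij, b, b', hb, hb', h⟩ := hnp
    have hinj : Function.Injective ![i, j] := by
      intro x y hxy
      fin_cases x <;> fin_cases y <;> simp_all
    exact isUncommon_of_pair hirr (τ := ⟨![i, j], hinj⟩) (b := ![b, b'])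
      (fun x => by fin_cases x <;> simpa) fun w hw => by
        rw [Fin.sum_univ_two]
        exact h w hw
  by_cases hz : ∃ i₀, ∀ w ∈ solSpace L, w i₀ = 0
  · obtain ⟨i₀, hzero⟩ := hz
    have hnp' : ∀ i j, i ≠ j → i ≠ i₀ → j ≠ i₀ → ∀ b b' : F,
        (∀ w ∈ solSpace L, b * w i + b' * w j = 0) → b = 0 ∧ b' = 0 := by
      have hne : ∀ i, i ≠ i₀ → ∃ w ∈ solSpace L, w i ≠ 0 := by
        intro i hi
        obtain ⟨w, hw, h⟩ := exists_ne_of_irredundant hirr hi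
        exact ⟨w, hw, by rwa [hzero w hw] at h⟩
      intro i j hij hi hj b b' h
      by_cases hb : b = 0
      · subst hb
        obtain ⟨w, hw, hw'⟩ := hne j hj
        simpa [hw'] using h w hw
      · by_cases hb' : b' = 0
        · subst hb'
          obtain ⟨w, hw, hw'⟩ := hne i hi
          simpa [hw'] using h w hw
        · obtain ⟨w, hw, hw'⟩ := hnp i j hij b b' hb hb'
          exact absurd (h w hw) hw'
    -- Drop the vanishing variable if it is among the four, and an arbitrary one otherwise.
    obtain ⟨p, hp⟩ : ∃ p, ∀ t, σ (Fin.succAbove p t) ≠ i₀ := by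
      by_cases h : ∃ p, σ p = i₀
      · obtain ⟨p, rfl⟩ := h
        exact ⟨p, fun t ht => Fin.succAbove_ne p t (σ.injective ht)⟩
      · push Not at h
        exact ⟨0, fun t => h _⟩
    obtain ⟨r, hr, hrp, -, hrel⟩ := exists_relation_of_minor_eq_zero hM (i := p) (j := p)
      (by simp only [minor]; ring)
    set τ : Fin 3 ↪ Fin k := (Fin.succAboveEmb p).trans σ with hτdef
    have hτ : ∀ j, τ j ≠ i₀ := hp
    have hrel' : ∀ w ∈ solSpace L, ∑ j : Fin 3, r (Fin.succAbove p j) * w (τ j) = 0 := by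
      intro w hw
      have := hrel _ (hσ' w hw)
      rw [Fin.sum_univ_succAbove _ p, hrp, zero_mul, zero_add] at this
      exact this
    -- A zero coefficient would leave a relation between two variables other than `i₀`, which must
    -- be trivial, making `r = 0`.
    refine isUncommon_of_triple hirr hnp hzero hτ (b := fun j => r (Fin.succAbove p j))
      (fun j hj => hr ?_) hrel'
    obtain ⟨a, b, hab, hja, hjb, hall⟩ : ∃ a b : Fin 3, a ≠ b ∧ j ≠ a ∧ j ≠ b ∧
        ∀ c, c ≠ a ∧ c ≠ b → c = j := by
      clear * -
      revert j
      decide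
    obtain ⟨ha0, hb0⟩ := hnp' (τ a) (τ b) (τ.injective.ne hab) (hτ a) (hτ b)
      (r (Fin.succAbove p a)) (r (Fin.succAbove p b)) fun w hw => by
        rw [← hrel' w hw, Fintype.sum_eq_add a b hab fun c hc => ?_]
        rw [hall c hc, hj, zero_mul]
    ext t
    rcases Fin.eq_self_or_eq_succAbove p t with rfl | ⟨c, rfl⟩
    · exact hrp
    · by_cases hca : c = a
      · rw [hca, ha0]; rfl
      · by_cases hcb : c = b
        · rw [hcb, hb0]; rfl
        · rw [hall c ⟨hca, hcb⟩, hj]; rfl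
  · push Not at hz
    have hnp' : ∀ i j, i ≠ j → ∀ b b' : F, b ≠ 0 →
        ∃ w ∈ solSpace L, b * w i + b' * w j ≠ 0 := by
      intro i j hij b b' hb
      by_cases hb' : b' = 0
      · obtain ⟨w, hw, hw'⟩ := hz i
        exact ⟨w, hw, by simpa [hb'] using ⟨hb, hw'⟩⟩
      · exact hnp i j hij b b' hb hb'
    -- A vanishing minor would yield a nontrivial relation between the two remaining variables,
    -- which `hnp'` forbids.
    refine isUncommon_of_quad h2 hirr hnp' (τ := σ) (M := M) (fun i j hij hmin => ?_)
      fun w hw s => congrFun (hσ' w hw) s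
    obtain ⟨r, hr, hri, hrj, hrel⟩ := exists_relation_of_minor_eq_zero hM hmin
    obtain ⟨a, b, hab, hall⟩ : ∃ a b : Fin 4, a ≠ b ∧ ∀ c, c ≠ a ∧ c ≠ b → c = i ∨ c = j := by
      clear * - hij
      revert i j
      decide
    have hrc : ∀ c, c ≠ a ∧ c ≠ b → r c = 0 := fun c hc => by
      rcases hall c hc with rfl | rfl
      · exact hri
      · exact hrj
    have hrel' : ∀ w ∈ solSpace L, r a * w (σ a) + r b * w (σ b) = 0 := fun w hw => by
      rw [← hrel _ (hσ' w hw), Fintype.sum_eq_add a b hab fun c hc => ?_]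
      rw [hrc c hc, zero_mul]
    refine hr (funext fun t => ?_)
    by_contra ht
    have hta : t = a ∨ t = b := by
      by_contra! h
      exact ht (hrc t h)
    rcases hta with rfl | rfl
    · obtain ⟨w, hw, hw'⟩ := hnp' (σ t) (σ b) (σ.injective.ne hab) (r t) (r b) ht
      exact hw' (hrel' w hw)
    · obtain ⟨w, hw, hw'⟩ := hnp' (σ t) (σ a) (σ.injective.ne (Ne.symm hab)) (r t) (r a) ht
      exact hw' ((add_comm _ _).trans (hrel' w hw))
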